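/- Let $n$ be a non-negative integer and let $\Gamma=\bigoplus_{m\ge 0}(\mathbb C^n)^{\otimes m}$ be the full Fock space over $\mathbb C^n$, with orthonormal basis $\{e_\alpha\}$ indexed by the words $\alpha$ in the letters $1,\dots,n$, and right creation operators $R_jf=f\otimes e_j$. An $n$-tuple $T=(T_1,\dots,T_n)$ of bounded operators on a complex Hilbert space $\mathcal H$ is a row contraction if the row operator $T:\mathcal H^n\to\mathcal H$, $(h_i)\mapsto\sum_i T_ih_i$, is a contraction. In this case put $D_T=(I-T^*T)^{1/2}$, $D_{T^*}=(I-TT^*)^{1/2}$, $\mathcal D_T=\overline{\operatorname{ran}}\,D_T\subseteq\mathcal H^n$, $\mathcal D_{T^*}=\overline{\operatorname{ran}}\,D_{T^*}\subseteq\mathcal H$. The characteristic function of $T$ is the operator $\Theta_T\in\mathcal B(\Gamma\otimes\mathcal D_T,\Gamma\otimes\mathcal D_{T^*})$, $$\Theta_T=\mathrm{SOT}\text{-}\lim_{r\to1^-}\Bigl[-\tilde T+(I_\Gamma\otimes D_{T^*})\bigl(I_{\Gamma\otimes\mathcal H}-r\tilde R\tilde T^*\bigr)^{-1}r\tilde R\,(I_\Gamma\otimes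 D_T)\Bigr]\Big|_{\Gamma\otimes\mathcal D_T},$$ where $\tilde T=(I_\Gamma\otimes T_1,\dots,I_\Gamma\otimes T_n)$ and $\tilde R=(R_1\otimes I_{\mathcal H},\dots,R_n\otimes I_{\mathcal H})$ are row operators from $(\Gamma\otimes\mathcal H)^n=\Gamma\otimes\mathcal H^n$ to $\Gamma\otimes\mathcal H$. Let $\mathcal H=\mathcal H_1\oplus\mathcal H_0\oplus\mathcal H_{-1}$ be an orthogonal direct sum of closed subspaces of a complex Hilbert space and let $T=(T_1,\dots,T_n)$ be a row contraction on $\mathcal H$ such that, with respect to this decomposition, $$T_i=\begin{bmatrix}S_i&*&*\\0&N_i&*\\0&0&C_i\end{bmatrix}\qquad(i=1,\dots,n).$$ Suppose that the row operator $S:\mathcal H_1^n\to\mathcal H_1$ is an isometry and that $C$ is a spherical co-isometry, that is, $\sum_iC_iC_i^*=I_{\mathcal H_{-1}}$. Then $N$ is a row contraction, the limits defining $\Theta_T$ and $\Theta_N$ exist, and there are a Hilbert space $\mathcal E$, a co-isometry $G_1\in\mathcal B(\Gamma\otimes(\mathcal D_{N^*}\oplus\mathcal E),\Gamma\otimes\mathcal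 D_{T^*})$ and an isometry $G_2\in\mathcal B(\Gamma\otimes\mathcal D_T,\Gamma\otimes(\mathcal D_N\oplus\mathcal E))$ such that $$\Theta_T=G_1\begin{bmatrix}\Theta_N&0\\0&I_{\Gamma\otimes\mathcal E}\end{bmatrix}G_2 .$$ Moreover, $G_1$ and $G_2$ can be chosen constant: $G_1=I_\Gamma\otimes g_1$ and $G_2=I_\Gamma\otimes g_2$ with $g_1\in\mathcal B(\mathcal D_{N^*}\oplus\mathcal E,\mathcal D_{T^*})$ and $g_2\in\mathcal B(\mathcal D_T,\mathcal D_N\oplus\mathcal E)$. -/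

import Mathlib

open Filter Topology
open scoped InnerProductSpace ENNReal

universe u

noncomputable section

namespace RowContraction

section Fock

variable {E F : Type*} [NormedAddCommGroup E] [InnerProductSpace ℂ E]
  [NormedAddCommGroup F] [InnerProductSpace ℂ F]

/-- The Hilbert space tensor product `Γ ⊗ E` of the full Fock space `Γ` over `ℂⁿ` with `E`.
Since the vectors `e_α`, for `α` in the free monoid on `n` generators, are an orthonormal basis
of `Γ`, this is the space of square-summable `E`-valued families indexed by the free monoid.
The elementary tensor `e_α ⊗ x` is `lp.single 2 α x`. -/
abbrev FockTensor (n : ℕ) (E : Type*) [NormedAddCommGroup E] : Type _ :=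
  lp (fun _ : FreeMonoid (Fin n) => E) 2

theorem memℓp_map {ι : Type*} (A : E →L[ℂ] F) (f : lp (fun _ : ι => E) 2) :
    Memℓp (fun a => A (f a)) 2 := by
  have hf := (lp.memℓp f).summable (by norm_num)
  refine memℓp_gen (Summable.of_nonneg_of_le (fun a => by positivity) (fun a => ?_)
    (hf.mul_left (‖A‖ ^ (2 : ℝ≥0∞).toReal)))
  rw [← Real.mul_rpow (norm_nonneg _) (norm_nonneg _)]
  exact Real.rpow_le_rpow (norm_nonneg _) (A.le_opNorm _) (by norm_num)

/-- The operator `I_Γ ⊗ A`. -/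
def ampl (n : ℕ) (A : E →L[ℂ] F) : FockTensor n E →L[ℂ] FockTensor n F :=
  LinearMap.mkContinuous
    { toFun := fun f => ⟨fun a => A (f a), memℓp_map A f⟩
      map_add' := fun f g => by
        ext a
        exact map_add A (f a) (g a)
      map_smul' := fun c f => by
        ext a
        exact map_smul A c (f a) }
    ‖A‖ (fun f => by
      refine lp.norm_le_of_forall_sum_le (by norm_num) (by positivity) (fun s => ?_)
      rw [Real.mul_rpow (norm_nonneg _) (norm_nonneg _)]
      refine le_trans ?_ (mul_le_mul_of_nonneg_left
        (lp.sum_rpow_le_norm_rpow (by norm_num) f s) (by positivity))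
      rw [Finset.mul_sum]
      refine Finset.sum_le_sum (fun a _ => ?_)
      rw [← Real.mul_rpow (norm_nonneg _) (norm_nonneg _)]
      exact Real.rpow_le_rpow (norm_nonneg _) (A.le_opNorm _) (by norm_num))

@[simp] theorem ampl_apply (n : ℕ) (A : E →L[ℂ] F) (f : FockTensor n E)
    (a : FreeMonoid (Fin n)) : ampl n A f a = A (f a) := rfl

theorem mul_of_injective {n : ℕ} (j : Fin n) :
    Function.Injective (fun a : FreeMonoid (Fin n) => a * FreeMonoid.of j) :=
  fun _ _ h => mul_right_cancel h

theorem hasSum_extend {E : Type*} [NormedAddCommGroup E] {ι : Type*} {φ : ι → ι}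
    (hφ : Function.Injective φ)
    (f : lp (fun _ : ι => E) 2) :
    HasSum (fun b => ‖Function.extend φ (fun a => f a) 0 b‖ ^ (2 : ℝ≥0∞).toReal)
      (‖f‖ ^ (2 : ℝ≥0∞).toReal) := by
  refine (hφ.hasSum_iff ?_).1 ?_
  · intro b hb
    rw [Function.extend_apply' _ _ _ (fun ⟨a, ha⟩ => hb ⟨a, ha⟩)]
    simp
  · have h := lp.hasSum_norm (p := 2) (by norm_num) f
    simpa [Function.comp_def, hφ.extend_apply] using h

/-- The operator `R_j ⊗ I_E`, where `R_j` is the right creation operator `f ↦ f ⊗ e_j`: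
it sends `e_α ⊗ x` to `e_{αj} ⊗ x`. -/
def rightCreation {n : ℕ} (E : Type*) [NormedAddCommGroup E] [InnerProductSpace ℂ E]
    (j : Fin n) : FockTensor n E →L[ℂ] FockTensor n E :=
  LinearMap.mkContinuous
    { toFun := fun f =>
        ⟨Function.extend (fun a => a * FreeMonoid.of j) (fun a => f a) 0,
          memℓp_gen (hasSum_extend (mul_of_injective j) f).summable⟩
      map_add' := fun f g => by
        ext b
        change Function.extend (fun a => a * FreeMonoid.of j) (fun a => f a + g a) 0 b =
          Function.extend (fun a => a * FreeMonoid.of j) (fun a => f a) 0 b +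
          Function.extend (fun a => a * FreeMonoid.of j) (fun a => g a) 0 b
        by_cases hb : ∃ a, a * FreeMonoid.of j = b
        · obtain ⟨a, rfl⟩ := hb
          simp [(mul_of_injective j).extend_apply]
        · simp [Function.extend_apply' _ _ _ hb]
      map_smul' := fun c f => by
        ext b
        by_cases hb : ∃ a, a * FreeMonoid.of j = b
        · obtain ⟨a, rfl⟩ := hb
          simp [(mul_of_injective j).extend_apply]
        · simp [Function.extend_apply' _ _ _ hb] }
    1 (fun f => by
      rw [one_mul]
      exact lp.norm_le_of_tsum_le (by norm_num) (norm_nonneg _)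
        (hasSum_extend (mul_of_injective j) f).tsum_eq.le)

end Fock

section Defect

variable {X Y : Type*} [NormedAddCommGroup X] [InnerProductSpace ℂ X] [CompleteSpace X]
  [NormedAddCommGroup Y] [InnerProductSpace ℂ Y] [CompleteSpace Y]

/-- The defect operator `D_A = (I - A* A)^{1/2}` of a contraction `A`. -/
def defectOp (A : X →L[ℂ] Y) : X →L[ℂ] X :=
  CFC.sqrt (1 - (ContinuousLinearMap.adjoint A) ∘L A)

/-- The defect space, the closure of the range of `D_A`. -/
abbrev defectSpace (A : X →L[ℂ] Y) : Submodule ℂ X :=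
  (LinearMap.range (defectOp A).toLinearMap).topologicalClosure

end Defect

section Row

variable {n : ℕ} {H : Type*} [NormedAddCommGroup H] [InnerProductSpace ℂ H]

/-- The row operator `Hⁿ → H`, `(h₁, …, hₙ) ↦ ∑ Tᵢ hᵢ`, on the Hilbert space direct sum `Hⁿ`. -/
def row (T : Fin n → H →L[ℂ] H) : PiLp 2 (fun _ : Fin n => H) →L[ℂ] H :=
  ∑ i, T i ∘L PiLp.proj 2 (fun _ : Fin n => H) i

/-- The row operator is a contraction. -/
def IsRowContraction (T : Fin n → H →L[ℂ] H) : Prop := ‖row T‖ ≤ 1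

/-- The row operator is an isometry. -/
def IsRowIsometry (T : Fin n → H →L[ℂ] H) : Prop := Isometry (row T)

/-- The tuple is a spherical co-isometry: `∑ Tᵢ Tᵢ* = I`. -/
def IsSphericalCoisometry [CompleteSpace H] (T : Fin n → H →L[ℂ] H) : Prop :=
  ∑ i, T i ∘L ContinuousLinearMap.adjoint (T i) = 1

/-- The row operator `R̃ = (R₁ ⊗ I, …, Rₙ ⊗ I)` from `(Γ ⊗ H)ⁿ = Γ ⊗ Hⁿ` to `Γ ⊗ H`. -/
def creationRow (n : ℕ) (H : Type*) [NormedAddCommGroup H] [InnerProductSpace ℂ H] :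
    FockTensor n (PiLp 2 (fun _ : Fin n => H)) →L[ℂ] FockTensor n H :=
  ∑ j, rightCreation H j ∘L ampl n (PiLp.proj 2 (fun _ : Fin n => H) j)

variable [CompleteSpace H]

/-- The space `𝒟_T ⊆ Hⁿ`. -/
abbrev DSpace (T : Fin n → H →L[ℂ] H) : Submodule ℂ (PiLp 2 (fun _ : Fin n => H)) :=
  defectSpace (row T)

/-- The space `𝒟_{T*} ⊆ H`, the closure of the range of `(I - T T*)^{1/2}`. -/
abbrev DStarSpace (T : Fin n → H →L[ℂ] H) : Submodule ℂ H :=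
  defectSpace (ContinuousLinearMap.adjoint (row T))

/-- The operator
`Θ_T(r R̃) = -T̃ + D_{T̃*} (I - r R̃ T̃*)⁻¹ r R̃ D_{T̃}` from `Γ ⊗ Hⁿ` to `Γ ⊗ H`,
where `T̃ = I ⊗ T`. For a row contraction `T` and `0 ≤ r < 1`, the operator `r R̃ T̃*` has norm
less than one. -/
def charFnRadial (T : Fin n → H →L[ℂ] H) (r : ℝ) :
    FockTensor n (PiLp 2 (fun _ : Fin n => H)) →L[ℂ] FockTensor n H :=
  - ampl n (row T) +
    ampl n (defectOp (ContinuousLinearMap.adjoint (row T))) ∘L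
      Ring.inverse (1 - (r : ℂ) • (creationRow n H ∘L
        ampl n (ContinuousLinearMap.adjoint (row T)))) ∘L
      ((r : ℂ) • creationRow n H) ∘L
      ampl n (defectOp (row T))

/-- `Θ : Γ ⊗ 𝒟_T → Γ ⊗ 𝒟_{T*}` is the limit of the operators `Θ_T(r R̃)`, restricted to
`Γ ⊗ 𝒟_T`, in the strong operator topology as `r → 1⁻`. -/
def IsCharFn (T : Fin n → H →L[ℂ] H)
    (Θ : FockTensor n (DSpace T) →L[ℂ] FockTensor n (DStarSpace T)) : Prop :=
  ∀ ξ : FockTensor n (DSpace T),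
    Tendsto (fun r : ℝ => charFnRadial T r (ampl n (DSpace T).subtypeL ξ)) (𝓝[<] 1)
      (𝓝 (ampl n (DStarSpace T).subtypeL (Θ ξ)))

open Classical in
/-- The characteristic function `Θ_T : Γ ⊗ 𝒟_T → Γ ⊗ 𝒟_{T*}` of a row contraction: the limit
described in `IsCharFn`. -/
def charFn (T : Fin n → H →L[ℂ] H) :
    FockTensor n (DSpace T) →L[ℂ] FockTensor n (DStarSpace T) :=
  if h : ∃ Θ, IsCharFn T Θ then h.choose else 0

end Row

section Block

variable {A A' B B' : Type*}
  [NormedAddCommGroup A] [InnerProductSpace ℂ A] [NormedAddCommGroup A'] [InnerProductSpace ℂ A']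
  [NormedAddCommGroup B] [InnerProductSpace ℂ B] [NormedAddCommGroup B'] [InnerProductSpace ℂ B']

/-- The inclusion of the first summand of a Hilbert space direct sum. -/
def inlL (A B : Type*) [NormedAddCommGroup A] [InnerProductSpace ℂ A]
    [NormedAddCommGroup B] [InnerProductSpace ℂ B] : A →L[ℂ] WithLp 2 (A × B) :=
  (WithLp.prodContinuousLinearEquiv 2 ℂ A B).symm.toContinuousLinearMap ∘L
    ContinuousLinearMap.inl ℂ A B

/-- The inclusion of the second summand of a Hilbert space direct sum. -/
def inrL (A B : Type*) [NormedAddCommGroup A] [InnerProductSpace ℂ A]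
    [NormedAddCommGroup B] [InnerProductSpace ℂ B] : B →L[ℂ] WithLp 2 (A × B) :=
  (WithLp.prodContinuousLinearEquiv 2 ℂ A B).symm.toContinuousLinearMap ∘L
    ContinuousLinearMap.inr ℂ A B

/-- The block diagonal operator `diag(Φ, Ψ)` from `Γ ⊗ (A ⊕ B) = (Γ ⊗ A) ⊕ (Γ ⊗ B)` to
`Γ ⊗ (A' ⊕ B') = (Γ ⊗ A') ⊕ (Γ ⊗ B')`. -/
def blockDiag {n : ℕ} (Φ : FockTensor n A →L[ℂ] FockTensor n A')
    (Ψ : FockTensor n B →L[ℂ] FockTensor n B') :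
    FockTensor n (WithLp 2 (A × B)) →L[ℂ] FockTensor n (WithLp 2 (A' × B')) :=
  ampl n (inlL A' B') ∘L Φ ∘L ampl n (WithLp.fstL 2 ℂ A B) +
    ampl n (inrL A' B') ∘L Ψ ∘L ampl n (WithLp.sndL 2 ℂ A B)

end Block

/-- The block `P_L A|_K : K → L` of an operator `A`, the entry of its operator matrix in the
row of `L` and the column of `K`. -/
def block {H : Type*} [NormedAddCommGroup H] [InnerProductSpace ℂ H] (L K : Submodule ℂ H)
    [L.HasOrthogonalProjection] (A : H →L[ℂ] H) : K →L[ℂ] L :=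
  L.orthogonalProjectionOnto ∘L A ∘L K.subtypeL

end RowContraction

end

open RowContraction

noncomputable section

namespace RowContraction

/-! ### Defect operators and defect spaces of a contraction -/

section DefectLemmas

variable {X Y : Type*} [NormedAddCommGroup X] [InnerProductSpace ℂ X] [CompleteSpace X]
  [NormedAddCommGroup Y] [InnerProductSpace ℂ Y] [CompleteSpace Y]

/-! Read in coordinates, `Θ_T ξ` at a word `α` is `D_{T*} u(α) - T ξ(α)`, where `u` is the backward
orbit `u(1) = 0`, `u(αj) = (D_T ξ(α))_j + T_j* u(α)` (`charFn_spec`). The theorem splits into a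
statement about orbits and a statement about constants.

Orbits. Since `S` is a row isometry, `D_T` kills `K₁ⁿ`, so the inputs `(D_T ξ(α))_j` lie in `K₁ᗮ`;
this space is invariant under every `T_j*`, so `u` stays in it. Triangularity makes the projection
`P₀` onto `K₀` intertwine `T_j*` on `K₁ᗮ` with `N_j*`, so `P₀ u` is the backward orbit of `N` with
inputs `P₀ (D_T ξ(α))_j` (`backwardOrbit_compression`). Since `C` is a spherical co-isometry,
`D_{T*}` kills `K₂`, and hence `D_{T*} u = D_{T*} P₀ u`.

Constants. Write `N = W* T V` as row operators, with `W` the inclusion of `K₀` and `V = Wⁿ`.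
Contractions `A`, `B` are defined by `A D_{N*} = D_{T*} W` and `B D_N = D_T V`, so that `D_N B* = V*
D_T`. With `g₁ = (A, a*)` and `g₂ = (B*, b)`, the orbit terms match whatever `a` and `b` are. The
other requirements are `b*b = 1 - BB*`, `a*a = 1 - AA*` and `a*b = A N B* - T` on the defect spaces.
Such a pair exists once the corresponding `2 × 2` operator matrix is positive
(`exists_gram_factorization`), and this positivity is the inequality `norm_sq_compression_le`, valid
for every compression of a contraction. -/

theorem norm_adjoint_le {A : X →L[ℂ] Y} (hA : ‖A‖ ≤ 1) : ‖A.adjoint‖ ≤ 1 := by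
  rwa [LinearIsometryEquiv.norm_map]

theorem norm_apply_le {X Y : Type*} [NormedAddCommGroup X] [NormedSpace ℂ X]
    [NormedAddCommGroup Y] [NormedSpace ℂ Y] {A : X →L[ℂ] Y} (hA : ‖A‖ ≤ 1) (x : X) :
    ‖A x‖ ≤ ‖x‖ := by
  simpa using A.le_of_opNorm_le hA x

theorem one_sub_adjoint_comp_self_nonneg {A : X →L[ℂ] Y} (hA : ‖A‖ ≤ 1) :
    0 ≤ 1 - A.adjoint ∘L A := by
  rw [ContinuousLinearMap.nonneg_iff_isPositive, ContinuousLinearMap.isPositive_def']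
  refine ⟨?_, fun x => ?_⟩
  · refine IsSelfAdjoint.sub (.one _) ?_
    rw [ContinuousLinearMap.isSelfAdjoint_iff', ContinuousLinearMap.adjoint_comp,
      ContinuousLinearMap.adjoint_adjoint]
  · have h := norm_apply_le hA x
    simp only [ContinuousLinearMap.reApplyInnerSelf_apply, sub_apply,
      one_apply_eq_self, ContinuousLinearMap.comp_apply, inner_sub_left,
      ContinuousLinearMap.adjoint_inner_left, map_sub, inner_self_eq_norm_sq, sub_nonneg]
    gcongr

theorem inner_defectOp_left (A : X →L[ℂ] Y) (x y : X) :
    ⟪defectOp A x, y⟫_ℂ = ⟪x, defectOp A y⟫_ℂ := by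
  have h : IsSelfAdjoint (defectOp A) := IsSelfAdjoint.of_nonneg (CFC.sqrt_nonneg _)
  rw [← ContinuousLinearMap.adjoint_inner_left, h.adjoint_eq]

theorem defectOp_defectOp {A : X →L[ℂ] Y} (hA : ‖A‖ ≤ 1) (x : X) :
    defectOp A (defectOp A x) = x - A.adjoint (A x) := by
  have h := CFC.sqrt_mul_sqrt_self (1 - A.adjoint ∘L A) (one_sub_adjoint_comp_self_nonneg hA)
  simpa [defectOp] using congr($h x)

theorem inner_defectOp_defectOp {A : X →L[ℂ] Y} (hA : ‖A‖ ≤ 1) (x y : X) :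
    ⟪defectOp A x, defectOp A y⟫_ℂ = ⟪x, y⟫_ℂ - ⟪A x, A y⟫_ℂ := by
  rw [inner_defectOp_left, defectOp_defectOp hA, inner_sub_right,
    ContinuousLinearMap.adjoint_inner_right]

theorem norm_sq_defectOp {A : X →L[ℂ] Y} (hA : ‖A‖ ≤ 1) (x : X) :
    ‖defectOp A x‖ ^ 2 = ‖x‖ ^ 2 - ‖A x‖ ^ 2 := by
  have h := congr(RCLike.re $(inner_defectOp_defectOp hA x x))
  simpa only [map_sub, inner_self_eq_norm_sq] using h

theorem commute_of_commute_mul_self {P A : X →L[ℂ] X} (hP : 0 ≤ P) (h : Commute (P * P) A) :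
    Commute P A := by
  rw [← CFC.sqrt_mul_self P hP]
  exact h.cfcₙ_nnreal _

/-- A positive operator intertwined by `A` with a positive operator has its square root
intertwined by `A` with the square root. -/
theorem sqrt_comp_of_intertwine (A : X →L[ℂ] Y) {P : X →L[ℂ] X} {Q : Y →L[ℂ] Y}
    (hP : 0 ≤ P) (hQ : 0 ≤ Q) (h : A ∘L P = Q ∘L A) : A ∘L CFC.sqrt P = CFC.sqrt Q ∘L A := by
  -- On `X ⊕ Y` the intertwining relation says that `diag(P, Q)` commutes with the operator whose
  -- only nonzero entry is `A`. The functional calculus then gives commutation with `diag(√P, √Q)`.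
  let d (P : X →L[ℂ] X) (Q : Y →L[ℂ] Y) : WithLp 2 (X × Y) →L[ℂ] WithLp 2 (X × Y) :=
    inlL X Y ∘L P ∘L WithLp.fstL 2 ℂ X Y + inrL X Y ∘L Q ∘L WithLp.sndL 2 ℂ X Y
  let a : WithLp 2 (X × Y) →L[ℂ] WithLp 2 (X × Y) := inrL X Y ∘L A ∘L WithLp.fstL 2 ℂ X Y
  have hd (P : X →L[ℂ] X) (Q : Y →L[ℂ] Y) (z) : d P Q z = WithLp.toLp 2 (P z.fst, Q z.snd) := by
    apply WithLp.ofLp_injective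
    simp [d, inlL, inrL]
  have ha (z) : a z = WithLp.toLp 2 (0, A z.fst) := by
    apply WithLp.ofLp_injective
    simp [a, inrL]
  have hpos : 0 ≤ d (CFC.sqrt P) (CFC.sqrt Q) := by
    have h1 := (ContinuousLinearMap.nonneg_iff_isPositive _).1 (CFC.sqrt_nonneg P)
    have h2 := (ContinuousLinearMap.nonneg_iff_isPositive _).1 (CFC.sqrt_nonneg Q)
    rw [ContinuousLinearMap.nonneg_iff_isPositive, ContinuousLinearMap.isPositive_def]
    refine ⟨fun x y => ?_, fun x => ?_⟩
    · simp only [ContinuousLinearMap.coe_coe, hd, WithLp.prod_inner_apply]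
      exact congr_arg₂ _ (h1.inner_left_eq_inner_right _ _) (h2.inner_left_eq_inner_right _ _)
    · simp only [ContinuousLinearMap.reApplyInnerSelf_apply, hd, WithLp.prod_inner_apply, map_add]
      exact add_nonneg (h1.re_inner_nonneg_left _) (h2.re_inner_nonneg_left _)
  have hsq : d (CFC.sqrt P) (CFC.sqrt Q) * d (CFC.sqrt P) (CFC.sqrt Q) = d P Q := by
    ext1 z
    have h1 := congr($(CFC.sqrt_mul_sqrt_self P hP) z.fst)
    have h2 := congr($(CFC.sqrt_mul_sqrt_self Q hQ) z.snd)
    simp only [mul_apply_eq_comp] at h1 h2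
    simp [hd, h1, h2]
  have hcomm : Commute (d P Q) a := by
    ext1 z
    have := congr($h z.fst)
    simp only [ContinuousLinearMap.comp_apply] at this
    simp [hd, ha, this]
  have hs : Commute (d (CFC.sqrt P) (CFC.sqrt Q)) a := by
    refine commute_of_commute_mul_self hpos ?_
    rwa [hsq]
  ext1 x
  have := congr(($hs.eq (WithLp.toLp 2 (x, 0))).snd)
  simpa [hd, ha] using this.symm

/-- The relation `A (1 - A*A) = (1 - AA*) A` passes to square roots. -/
theorem apply_defectOp {A : X →L[ℂ] Y} (hA : ‖A‖ ≤ 1) (x : X) :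
    A (defectOp A x) = defectOp A.adjoint (A x) := by
  have h := sqrt_comp_of_intertwine A (one_sub_adjoint_comp_self_nonneg hA)
    (one_sub_adjoint_comp_self_nonneg (norm_adjoint_le hA))
    (by ext x; simp)
  exact congr($h x)

/-- The Julia operator of a contraction is isometric. -/
theorem norm_sq_julia {A : X →L[ℂ] Y} (hA : ‖A‖ ≤ 1) (x : X) (y : Y) :
    ‖A.adjoint y + defectOp A x‖ ^ 2 + ‖defectOp A.adjoint y - A x‖ ^ 2 =
      ‖x‖ ^ 2 + ‖y‖ ^ 2 := by
  -- The two cross terms cancel because `A D_A = D_{A*} A`.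
  rw [norm_add_sq (𝕜 := ℂ), norm_sub_sq (𝕜 := ℂ), norm_sq_defectOp hA,
    norm_sq_defectOp (norm_adjoint_le hA), ContinuousLinearMap.adjoint_inner_left,
    apply_defectOp hA, inner_defectOp_left]
  ring

/-- The defect operator as an operator with values in the defect space. -/
def defectMap (A : X →L[ℂ] Y) : X →L[ℂ] defectSpace A :=
  (defectOp A).codRestrict (defectSpace A) fun x =>
    Submodule.le_topologicalClosure _ ⟨x, rfl⟩

@[simp] theorem coe_defectMap (A : X →L[ℂ] Y) (x : X) : (defectMap A x : X) = defectOp A x := rfl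

theorem denseRange_defectMap (A : X →L[ℂ] Y) : DenseRange (defectMap A) := by
  intro y
  rw [closure_subtype]
  convert! y.2
  rw [← Set.range_comp]
  rfl

theorem apply_mem_defectSpace {A : X →L[ℂ] Y} (hA : ‖A‖ ≤ 1) (x : defectSpace A) :
    A x ∈ defectSpace A.adjoint := by
  refine (denseRange_defectMap A).induction_on
    (p := fun x : defectSpace A => A x ∈ defectSpace A.adjoint) x ?_ fun x => ?_
  · exact (Submodule.isClosed_topologicalClosure _).preimage (by fun_prop)
  · rw [coe_defectMap, apply_defectOp hA]
    exact (defectMap A.adjoint (A x)).2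

/-- The restriction of a contraction to an operator between its defect spaces. -/
def defectRestrict (A : X →L[ℂ] Y) (hA : ‖A‖ ≤ 1) :
    defectSpace A →L[ℂ] defectSpace A.adjoint :=
  (A ∘L (defectSpace A).subtypeL).codRestrict _ fun x => apply_mem_defectSpace hA x

@[simp] theorem coe_defectRestrict {A : X →L[ℂ] Y} (hA : ‖A‖ ≤ 1) (x : defectSpace A) :
    (defectRestrict A hA x : Y) = A x := rfl

/-- Douglas factorization through a defect operator. -/
theorem exists_defect_factor {Z : Type*} [NormedAddCommGroup Z] [InnerProductSpace ℂ Z]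
    [CompleteSpace Z] (A : X →L[ℂ] Y) (q : X →L[ℂ] Z) (h : ∀ x, ‖q x‖ ≤ ‖defectOp A x‖) :
    ∃ B : defectSpace A →L[ℂ] Z, ‖B‖ ≤ 1 ∧ ∀ x, B (defectMap A x) = q x := by
  have hq : ∀ x, ‖(q : X →ₗ[ℂ] Z) x‖ ≤ 1 * ‖(defectMap A : X →ₗ[ℂ] defectSpace A) x‖ := by
    simpa using h
  refine ⟨(q : X →ₗ[ℂ] Z).extendOfNorm (defectMap A : X →ₗ[ℂ] defectSpace A), ?_, fun x => ?_⟩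
  · exact LinearMap.opNorm_extendOfNorm_le (denseRange_defectMap A) zero_le_one hq
  · exact LinearMap.extendOfNorm_eq (denseRange_defectMap A) ⟨1, hq⟩ x

end DefectLemmas

/-! ### Gram factorization and the inequality for compressions -/

section ConstantFactors

theorem inner_sqrt_sqrt {X : Type*} [NormedAddCommGroup X] [InnerProductSpace ℂ X] [CompleteSpace X]
    {M : X →L[ℂ] X} (hM : 0 ≤ M) (x y : X) : ⟪CFC.sqrt M x, CFC.sqrt M y⟫_ℂ = ⟪M x, y⟫_ℂ := by
  have h : IsSelfAdjoint (CFC.sqrt M) := IsSelfAdjoint.of_nonneg (CFC.sqrt_nonneg _)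
  rw [← ContinuousLinearMap.adjoint_inner_left, h.adjoint_eq]
  exact congr(⟪$(CFC.sqrt_mul_sqrt_self M hM) x, y⟫_ℂ)

theorem inlL_apply {X Y : Type*} [NormedAddCommGroup X] [InnerProductSpace ℂ X]
    [NormedAddCommGroup Y] [InnerProductSpace ℂ Y] (x : X) :
    inlL X Y x = WithLp.toLp 2 (x, 0) := by
  apply WithLp.ofLp_injective
  simp [inlL]

theorem inrL_apply {X Y : Type*} [NormedAddCommGroup X] [InnerProductSpace ℂ X]
    [NormedAddCommGroup Y] [InnerProductSpace ℂ Y] (y : Y) :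
    inrL X Y y = WithLp.toLp 2 (0, y) := by
  apply WithLp.ofLp_injective
  simp [inrL]

theorem prod_inner_eq {X Y : Type*} [NormedAddCommGroup X] [InnerProductSpace ℂ X]
    [NormedAddCommGroup Y] [InnerProductSpace ℂ Y] (z w : WithLp 2 (X × Y)) :
    ⟪z, w⟫_ℂ = ⟪z.fst, w.fst⟫_ℂ + ⟪z.snd, w.snd⟫_ℂ := WithLp.prod_inner_apply z w

/-- A positive semidefinite `2 × 2` operator matrix with rows `(P, R*)` and `(R, Q)` is the Gram
matrix of a pair of operators. -/
theorem exists_gram_factorization {X Y : Type*}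
    [NormedAddCommGroup X] [InnerProductSpace ℂ X] [CompleteSpace X]
    [NormedAddCommGroup Y] [InnerProductSpace ℂ Y] [CompleteSpace Y]
    {P : X →L[ℂ] X} {Q : Y →L[ℂ] Y} {R : X →L[ℂ] Y}
    (hP : ∀ x x', ⟪P x, x'⟫_ℂ = ⟪x, P x'⟫_ℂ) (hQ : ∀ y y', ⟪Q y, y'⟫_ℂ = ⟪y, Q y'⟫_ℂ)
    (hpos : ∀ x y, 0 ≤ RCLike.re ⟪P x, x⟫_ℂ + RCLike.re ⟪Q y, y⟫_ℂ + 2 * RCLike.re ⟪R x, y⟫_ℂ) :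
    ∃ (b : X →L[ℂ] WithLp 2 (X × Y)) (a : Y →L[ℂ] WithLp 2 (X × Y)),
      b.adjoint ∘L b = P ∧ a.adjoint ∘L a = Q ∧ a.adjoint ∘L b = R := by
  -- The hypotheses say that this block operator is positive; `b` and `a` will be the two columns of
  -- its square root.
  let M : WithLp 2 (X × Y) →L[ℂ] WithLp 2 (X × Y) :=
    inlL X Y ∘L (P ∘L WithLp.fstL 2 ℂ X Y + R.adjoint ∘L WithLp.sndL 2 ℂ X Y) +
      inrL X Y ∘L (R ∘L WithLp.fstL 2 ℂ X Y + Q ∘L WithLp.sndL 2 ℂ X Y)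
  have hM (z) : M z = WithLp.toLp 2 (P z.fst + R.adjoint z.snd, R z.fst + Q z.snd) := by
    apply WithLp.ofLp_injective
    simp [M, inlL, inrL]
  have hM₁ (z) : (M z).fst = P z.fst + R.adjoint z.snd := by simp [hM]
  have hM₂ (z) : (M z).snd = R z.fst + Q z.snd := by simp [hM]
  have hM0 : 0 ≤ M := by
    rw [ContinuousLinearMap.nonneg_iff_isPositive, ContinuousLinearMap.isPositive_def]
    refine ⟨fun z w => ?_, fun z => ?_⟩
    · simp only [ContinuousLinearMap.coe_coe, hM₁, hM₂, prod_inner_eq, inner_add_left,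
        inner_add_right, hP, hQ, ContinuousLinearMap.adjoint_inner_left,
        ContinuousLinearMap.adjoint_inner_right]
      ring
    · have h := hpos z.fst z.snd
      have h' : RCLike.re ⟪z.snd, R z.fst⟫_ℂ = RCLike.re ⟪R z.fst, z.snd⟫_ℂ := inner_re_symm _ _
      simp only [ContinuousLinearMap.reApplyInnerSelf_apply, hM₁, hM₂, prod_inner_eq,
        inner_add_left, ContinuousLinearMap.adjoint_inner_left, map_add]
      linarith
  refine ⟨CFC.sqrt M ∘L inlL X Y, CFC.sqrt M ∘L inrL X Y, ?_, ?_, ?_⟩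
  all_goals
    refine ContinuousLinearMap.ext fun x => ext_inner_right ℂ fun y => ?_
    rw [ContinuousLinearMap.comp_apply, ContinuousLinearMap.adjoint_inner_left,
      ContinuousLinearMap.comp_apply, ContinuousLinearMap.comp_apply,
      inner_sqrt_sqrt hM0, hM, prod_inner_eq]
    simp [inlL_apply, inrL_apply]

variable {X Y X₀ Y₀ : Type*} [NormedAddCommGroup X] [InnerProductSpace ℂ X] [CompleteSpace X]
  [NormedAddCommGroup Y] [InnerProductSpace ℂ Y] [CompleteSpace Y]
  [NormedAddCommGroup X₀] [InnerProductSpace ℂ X₀] [CompleteSpace X₀]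
  [NormedAddCommGroup Y₀] [InnerProductSpace ℂ Y₀] [CompleteSpace Y₀]

theorem norm_apply_of_adjoint_comp {V : X₀ →L[ℂ] X} (hV : V.adjoint ∘L V = 1) (x : X₀) :
    ‖V x‖ = ‖x‖ := by
  have h := V.adjoint_inner_left x (V x)
  rw [← ContinuousLinearMap.comp_apply, hV, one_apply_eq_self, inner_self_eq_norm_sq_to_K,
    inner_self_eq_norm_sq_to_K] at h
  exact_mod_cast (pow_left_inj₀ (norm_nonneg _) (norm_nonneg _) two_ne_zero).1
    (by exact_mod_cast h.symm)

theorem norm_le_one_of_adjoint_comp {V : X₀ →L[ℂ] X} (hV : V.adjoint ∘L V = 1) : ‖V‖ ≤ 1 :=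
  V.opNorm_le_bound zero_le_one fun x => by rw [norm_apply_of_adjoint_comp hV, one_mul]

theorem norm_compression_le {T : X →L[ℂ] Y} (hT : ‖T‖ ≤ 1) {V : X₀ →L[ℂ] X} {W : Y₀ →L[ℂ] Y}
    (hV : V.adjoint ∘L V = 1) (hW : W.adjoint ∘L W = 1) : ‖W.adjoint ∘L T ∘L V‖ ≤ 1 := by
  refine ContinuousLinearMap.opNorm_le_bound _ zero_le_one fun x => ?_
  rw [one_mul, ← norm_apply_of_adjoint_comp hV]
  exact (norm_apply_le (norm_adjoint_le (norm_le_one_of_adjoint_comp hW)) _).trans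
    (norm_apply_le hT _)

/-- Compressing by `W*` can only shorten `T V x`, so it can only enlarge the defect. This is the
hypothesis of the Douglas factorization. -/
theorem norm_defectOp_le_compression {T : X →L[ℂ] Y} (hT : ‖T‖ ≤ 1) {V : X₀ →L[ℂ] X}
    {W : Y₀ →L[ℂ] Y} (hV : V.adjoint ∘L V = 1) (hW : W.adjoint ∘L W = 1) (x : X₀) :
    ‖defectOp T (V x)‖ ≤ ‖defectOp (W.adjoint ∘L T ∘L V) x‖ := by
  have h : ‖W.adjoint (T (V x))‖ ≤ ‖T (V x)‖ :=
    norm_apply_le (norm_adjoint_le (norm_le_one_of_adjoint_comp hW)) _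
  rw [← sq_le_sq₀ (norm_nonneg _) (norm_nonneg _), norm_sq_defectOp hT,
    norm_sq_defectOp (norm_compression_le hT hV hW), norm_apply_of_adjoint_comp hV]
  simp only [ContinuousLinearMap.comp_apply]
  gcongr

theorem norm_sq_sub_range_proj {V : X₀ →L[ℂ] X} (hV : V.adjoint ∘L V = 1) (x : X) :
    ‖x - V (V.adjoint x)‖ ^ 2 = ‖x‖ ^ 2 - ‖V.adjoint x‖ ^ 2 := by
  rw [norm_sub_sq (𝕜 := ℂ), norm_apply_of_adjoint_comp hV, ← V.adjoint_inner_left,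
    inner_self_eq_norm_sq]
  ring

/-- A vector of a defect space is controlled by its inner products with the range of the defect
operator. -/
theorem norm_le_of_inner_defectOp {A : X →L[ℂ] Y} {v : X} (hv : v ∈ defectSpace A) {c : ℝ}
    (hc : 0 ≤ c) (h : ∀ x, ‖⟪v, defectOp A x⟫_ℂ‖ ≤ c * ‖defectOp A x‖) : ‖v‖ ≤ c := by
  have hs : IsClosed {w : X | ‖⟪v, w⟫_ℂ‖ ≤ c * ‖w‖} :=
    isClosed_le (continuous_const.inner continuous_id).norm (continuous_const.mul continuous_norm)
  -- The bound is a closed condition on the second vector, so it extends from the range to `v`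
  -- itself.
  have hvv : ‖⟪v, v⟫_ℂ‖ ≤ c * ‖v‖ :=
    closure_minimal (s := Set.range (defectOp A)) (by rintro _ ⟨x, rfl⟩; exact h x) hs hv
  rw [inner_self_eq_norm_sq_to_K, norm_pow, RCLike.norm_ofReal, abs_norm] at hvv
  nlinarith [norm_nonneg v]

/-- For a compression `N = W* T V` of a contraction `T`, let `b` and `a` be related to `x` and `y`
by `D_N b = V* D_T x` and `D_{N*} a = W* D_{T*} y`. Then
`‖N b - a‖² ≤ ‖T x - y‖² + ‖(1 - V V*) D_T x‖²`. -/
theorem norm_sq_compression_le {T : X →L[ℂ] Y} (hT : ‖T‖ ≤ 1) {V : X₀ →L[ℂ] X}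
    {W : Y₀ →L[ℂ] Y} (hV : V.adjoint ∘L V = 1) (hW : W.adjoint ∘L W = 1)
    {N : X₀ →L[ℂ] Y₀} (hNT : N = W.adjoint ∘L T ∘L V) (hN : ‖N‖ ≤ 1)
    {x : X} {y : Y} {b : X₀} {a : Y₀}
    (hb : defectOp N b = V.adjoint (defectOp T x))
    (ha : defectOp N.adjoint a = W.adjoint (defectOp T.adjoint y))
    (hmem : N b - a ∈ defectSpace N.adjoint) :
    ‖N b - a‖ ^ 2 ≤
      ‖T x - y‖ ^ 2 + (‖defectOp T x‖ ^ 2 - ‖V.adjoint (defectOp T x)‖ ^ 2) := by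
  obtain ⟨d, hd⟩ : ∃ d, d = defectOp T x := ⟨_, rfl⟩
  obtain ⟨p, hp⟩ : ∃ p, p = d - V (V.adjoint d) := ⟨_, rfl⟩
  have hpd : ‖p‖ ^ 2 = ‖d‖ ^ 2 - ‖V.adjoint d‖ ^ 2 := hp ▸ norm_sq_sub_range_proj hV d
  rw [← hd]
  refine le_of_le_of_eq ?_ (congrArg (‖T x - y‖ ^ 2 + ·) hpd)
  -- Here `p = (1 - V V*) D_T x`. It pairs with the part of `T* W k` outside the range of `V`, since
  -- `V* T* W k = N* k`.
  have hkey (k : Y₀) :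
      ⟪N b - a, defectOp N.adjoint k⟫_ℂ =
        ⟪T x - y, defectOp T.adjoint (W k)⟫_ℂ -
          ⟪p, T.adjoint (W k) - V (N.adjoint k)⟫_ℂ := by
    have h1 : ⟪N b, defectOp N.adjoint k⟫_ℂ = ⟪d, V (N.adjoint k)⟫_ℂ := by
      rw [← inner_defectOp_left, ← apply_defectOp hN, ← N.adjoint_inner_right, hb, ← hd,
        V.adjoint_inner_left]
    have h2 : ⟪a, defectOp N.adjoint k⟫_ℂ = ⟪y, defectOp T.adjoint (W k)⟫_ℂ := by
      rw [← inner_defectOp_left, ha, W.adjoint_inner_left, inner_defectOp_left]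
    have h3 : ⟪T x, defectOp T.adjoint (W k)⟫_ℂ = ⟪d, T.adjoint (W k)⟫_ℂ := by
      rw [hd, T.adjoint_inner_right, apply_defectOp hT, inner_defectOp_left]
    have h4 : V.adjoint (T.adjoint (W k) - V (N.adjoint k)) = 0 := by
      have : V.adjoint (V (N.adjoint k)) = N.adjoint k := congr($hV _)
      rw [map_sub, this, hNT]
      simp [ContinuousLinearMap.adjoint_comp]
    rw [inner_sub_left, h1, h2, inner_sub_left, h3, hp, inner_sub_left, ← V.adjoint_inner_right, h4,
      inner_zero_right, inner_sub_right]
    ring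
  -- The two test vectors of `hkey` together have exactly the length of `D_{N*} k`, so
  -- Cauchy–Schwarz for pairs gives the constant 1.
  have hz (k : Y₀) : ‖defectOp T.adjoint (W k)‖ ^ 2 + ‖T.adjoint (W k) - V (N.adjoint k)‖ ^ 2 =
      ‖defectOp N.adjoint k‖ ^ 2 := by
    have h : V.adjoint (T.adjoint (W k)) = N.adjoint k := by
      simp [hNT, ContinuousLinearMap.adjoint_comp]
    rw [norm_sq_defectOp (norm_adjoint_le hT), norm_sq_defectOp (norm_adjoint_le hN), ← h,
      norm_sq_sub_range_proj hV, norm_apply_of_adjoint_comp hW]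
    ring
  refine (Real.le_sqrt (norm_nonneg _) (by positivity)).1 ?_
  refine norm_le_of_inner_defectOp hmem (Real.sqrt_nonneg _) fun k => ?_
  rw [hkey]
  have h1 := norm_inner_le_norm (𝕜 := ℂ) (T x - y) (defectOp T.adjoint (W k))
  have h2 := norm_inner_le_norm (𝕜 := ℂ) p (T.adjoint (W k) - V (N.adjoint k))
  refine (norm_sub_le _ _).trans ((add_le_add h1 h2).trans ?_)
  refine (sq_le_sq₀ (by positivity) (by positivity)).1 ?_
  rw [mul_pow, Real.sq_sqrt (by positivity), ← hz]
  -- Lagrange's identity for the two-term Cauchy–Schwarz inequality.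
  nlinarith [sq_nonneg (‖T x - y‖ * ‖T.adjoint (W k) - V (N.adjoint k)‖ -
    ‖p‖ * ‖defectOp T.adjoint (W k)‖)]

end ConstantFactors

/-! ### Completing contractions to a co-isometry and an isometry -/

section CoisometricFactors

theorem toLp_fst {U V : Type*} (u : U) (v : V) : (WithLp.toLp 2 (u, v)).fst = u := rfl

theorem toLp_snd {U V : Type*} (u : U) (v : V) : (WithLp.toLp 2 (u, v)).snd = v := rfl

variable {D D' F F' : Type*} [NormedAddCommGroup D] [InnerProductSpace ℂ D] [CompleteSpace D]
  [NormedAddCommGroup D'] [InnerProductSpace ℂ D'] [CompleteSpace D']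
  [NormedAddCommGroup F] [InnerProductSpace ℂ F] [CompleteSpace F]
  [NormedAddCommGroup F'] [InnerProductSpace ℂ F'] [CompleteSpace F']

/-- The hypothesis is positivity of the matrix with diagonal `1 - BB*`, `1 - AA*` and corner `A ν B*
- t`. A Gram pair `b`, `a` gives `g₁ = (A, a*)` and `g₂ = (B*, b)`. The diagonal makes them
co-isometric and isometric, and the corner makes `-A ν B* + a* b` equal to `-t`. -/
theorem exists_isometric_factors {t : D →L[ℂ] D'} {ν : F →L[ℂ] F'} {A : F' →L[ℂ] D'}
    {B : F →L[ℂ] D}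
    (hpos : ∀ x y, 0 ≤ ‖x‖ ^ 2 - ‖B.adjoint x‖ ^ 2 + (‖y‖ ^ 2 - ‖A.adjoint y‖ ^ 2) +
      2 * (RCLike.re ⟪ν (B.adjoint x), A.adjoint y⟫_ℂ - RCLike.re ⟪t x, y⟫_ℂ)) :
    ∃ (g₁ : WithLp 2 (F' × WithLp 2 (D × D')) →L[ℂ] D')
      (g₂ : D →L[ℂ] WithLp 2 (F × WithLp 2 (D × D'))),
      g₁ ∘L g₁.adjoint = 1 ∧ g₂.adjoint ∘L g₂ = 1 ∧
      (∀ f, g₁ (WithLp.toLp 2 (f, 0)) = A f) ∧ (∀ x, (g₂ x).fst = B.adjoint x) ∧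
      ∀ x, g₁ (WithLp.toLp 2 (-ν (g₂ x).fst, (g₂ x).snd)) = -t x := by
  obtain ⟨b, a, hbb, haa, hab⟩ := exists_gram_factorization
    (P := 1 - B ∘L B.adjoint) (Q := 1 - A ∘L A.adjoint) (R := A ∘L ν ∘L B.adjoint - t)
    (fun x x' => by
      simp only [sub_apply, one_apply_eq_self, ContinuousLinearMap.comp_apply, inner_sub_left,
        inner_sub_right, ← B.adjoint_inner_left, ← B.adjoint_inner_right])
    (fun y y' => by
      simp only [sub_apply, one_apply_eq_self, ContinuousLinearMap.comp_apply, inner_sub_left,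
        inner_sub_right, ← A.adjoint_inner_left, ← A.adjoint_inner_right])
    (fun x y => by
      refine (hpos x y).trans_eq ?_
      simp only [sub_apply, one_apply_eq_self, ContinuousLinearMap.comp_apply, inner_sub_left,
        map_sub, inner_self_eq_norm_sq, ← A.adjoint_inner_right, ← B.adjoint_inner_right])
  have h₂ (x : D) : inlL F (WithLp 2 (D × D')) (B.adjoint x) + inrL _ _ (b x) =
      WithLp.toLp 2 (B.adjoint x, b x) := by
    simp [inlL_apply, inrL_apply, ← WithLp.toLp_add]
  let g₁ : WithLp 2 (F' × WithLp 2 (D × D')) →L[ℂ] D' :=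
    A ∘L WithLp.fstL 2 ℂ _ _ + a.adjoint ∘L WithLp.sndL 2 ℂ _ _
  let g₂ : D →L[ℂ] WithLp 2 (F × WithLp 2 (D × D')) :=
    inlL _ _ ∘L B.adjoint + inrL _ _ ∘L b
  have hg₁ (f e) : g₁ (WithLp.toLp 2 (f, e)) = A f + a.adjoint e := by simp [g₁]
  have hg₂ (x) : g₂ x = WithLp.toLp 2 (B.adjoint x, b x) := h₂ x
  have hg₁' (y) : g₁.adjoint y = WithLp.toLp 2 (A.adjoint y, a y) := by
    refine ext_inner_left ℂ fun z => ?_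
    rw [g₁.adjoint_inner_right, prod_inner_eq z, toLp_fst (A.adjoint y),
      toLp_snd _ (a y), A.adjoint_inner_right,
      ← a.adjoint_inner_left, ← inner_add_left]
    rfl
  refine ⟨g₁, g₂, ?_, ?_, fun f => ?_, fun x => ?_, fun x => ?_⟩
  · ext1 y
    have := congr($haa y)
    simp only [sub_apply, one_apply_eq_self, ContinuousLinearMap.comp_apply] at this
    rw [ContinuousLinearMap.comp_apply, hg₁', hg₁, this]
    simp
  · refine ContinuousLinearMap.ext fun x => ext_inner_right ℂ fun x' => ?_
    have := congr(⟪$hbb x, x'⟫_ℂ)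
    simp only [sub_apply, one_apply_eq_self, ContinuousLinearMap.comp_apply, inner_sub_left,
      b.adjoint_inner_left] at this
    rw [ContinuousLinearMap.comp_apply, g₂.adjoint_inner_left, hg₂, hg₂, prod_inner_eq, toLp_fst,
      toLp_snd,
      toLp_fst, toLp_snd, this, B.adjoint_inner_right]
    simp
  · rw [hg₁]; simp
  · rw [hg₂, toLp_fst]
  · have := congr($hab x)
    simp only [sub_apply, ContinuousLinearMap.comp_apply] at this
    rw [hg₂, hg₁, toLp_fst, toLp_snd, this, map_neg, neg_add_eq_sub, sub_sub_cancel_left]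

end CoisometricFactors

/-! ### Constant factors for a compression of a contraction -/

section Compression

variable {X Y X₀ Y₀ : Type*} [NormedAddCommGroup X] [InnerProductSpace ℂ X] [CompleteSpace X]
  [NormedAddCommGroup Y] [InnerProductSpace ℂ Y] [CompleteSpace Y]
  [NormedAddCommGroup X₀] [InnerProductSpace ℂ X₀] [CompleteSpace X₀]
  [NormedAddCommGroup Y₀] [InnerProductSpace ℂ Y₀] [CompleteSpace Y₀]

/-- The defect operator of an isometric compression of `T` factors through that of `T`. -/
theorem exists_compression_defect_factor {T : X →L[ℂ] Y} (hT : ‖T‖ ≤ 1) {V : X₀ →L[ℂ] X}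
    {W : Y₀ →L[ℂ] Y} (hV : V.adjoint ∘L V = 1) (hW : W.adjoint ∘L W = 1)
    {N : X₀ →L[ℂ] Y₀} (hNT : N = W.adjoint ∘L T ∘L V) :
    ∃ B : defectSpace N →L[ℂ] defectSpace T, (∀ h, B (defectMap N h) = defectMap T (V h)) ∧
      ∀ x : defectSpace T, defectOp N (B.adjoint x) = V.adjoint (defectOp T x) := by
  obtain ⟨B, -, hB⟩ := exists_defect_factor N (defectMap T ∘L V) (fun x => by
    subst hNT
    exact norm_defectOp_le_compression hT hV hW x)
  refine ⟨B, hB, fun x => ext_inner_right ℂ fun h => ?_⟩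
  -- The second relation is the adjoint of the first, both defect operators being self-adjoint.
  rw [inner_defectOp_left, V.adjoint_inner_left, inner_defectOp_left]
  calc ⟪((B.adjoint x : defectSpace N) : X₀), defectOp N h⟫_ℂ
      = ⟪B.adjoint x, defectMap N h⟫_ℂ := rfl
    _ = ⟪x, defectMap T (V h)⟫_ℂ := by rw [B.adjoint_inner_left, hB]; rfl
    _ = ⟪(x : X), defectOp T (V h)⟫_ℂ := rfl

-- No triangularity enters here. The last three properties match, in turn, the output map of the
-- orbit, its input, and the constant term of the characteristic function.
set_option maxHeartbeats 1000000 in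
theorem exists_constant_factors {T : X →L[ℂ] Y} (hT : ‖T‖ ≤ 1) {V : X₀ →L[ℂ] X}
    {W : Y₀ →L[ℂ] Y} (hV : V.adjoint ∘L V = 1) (hW : W.adjoint ∘L W = 1)
    {N : X₀ →L[ℂ] Y₀} (hNT : N = W.adjoint ∘L T ∘L V) (hN : ‖N‖ ≤ 1) :
    ∃ (g₁ : WithLp 2 (defectSpace N.adjoint × WithLp 2 (defectSpace T × defectSpace T.adjoint))
        →L[ℂ] defectSpace T.adjoint)
      (g₂ : defectSpace T →L[ℂ]
        WithLp 2 (defectSpace N × WithLp 2 (defectSpace T × defectSpace T.adjoint))),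
      g₁ ∘L g₁.adjoint = 1 ∧ g₂.adjoint ∘L g₂ = 1 ∧
      (∀ k, g₁ (WithLp.toLp 2 (defectMap N.adjoint k, 0)) = defectMap T.adjoint (W k)) ∧
      (∀ x, defectOp N (g₂ x).fst = V.adjoint (defectOp T x)) ∧
      ∀ x, g₁ (WithLp.toLp 2 (-defectRestrict N hN (g₂ x).fst, (g₂ x).snd)) =
        -defectRestrict T hT x := by
  obtain ⟨B, hB, hB'⟩ := exists_compression_defect_factor hT hV hW hNT
  have hNT' : N.adjoint = V.adjoint ∘L T.adjoint ∘L W := by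
    rw [hNT, ContinuousLinearMap.adjoint_comp, ContinuousLinearMap.adjoint_comp,
      ContinuousLinearMap.adjoint_adjoint, ContinuousLinearMap.comp_assoc]
  obtain ⟨A, hA, hA'⟩ :=
    -- `N* = V* T* W` is a compression of `T*`, with the roles of `V` and `W` exchanged.
    exists_compression_defect_factor (X := Y) (Y := X) (X₀ := Y₀) (Y₀ := X₀)
      (T := T.adjoint) (norm_adjoint_le hT) hW hV hNT'
  obtain ⟨g₁, g₂, h1, h2, h3, h4, h5⟩ := exists_isometric_factors
    (t := defectRestrict T hT) (ν := defectRestrict N hN) (A := A) (B := B) (fun x y => by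
      obtain ⟨b, hb⟩ : ∃ b, b = B.adjoint x := ⟨_, rfl⟩
      obtain ⟨a, ha⟩ : ∃ a, a = A.adjoint y := ⟨_, rfl⟩
      have hBx := hB' x
      have hAy := hA' y
      rw [← hb] at hBx ⊢
      rw [← ha] at hAy ⊢
      -- Expanding the squares and the defect norms, `‖T x‖²` and `‖N b‖²` cancel and the required
      -- positivity remains.
      have h := norm_sq_compression_le hT hV hW hNT hN hBx hAy
        (sub_mem (apply_mem_defectSpace hN b) a.2)
      rw [← hBx, norm_sq_defectOp hT, norm_sq_defectOp hN, norm_sub_sq (𝕜 := ℂ),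
        norm_sub_sq (𝕜 := ℂ)] at h
      change 0 ≤ ‖(x : X)‖ ^ 2 - ‖(b : X₀)‖ ^ 2 + (‖(y : Y)‖ ^ 2 - ‖(a : Y₀)‖ ^ 2) +
        2 * (RCLike.re ⟪N b, a⟫_ℂ - RCLike.re ⟪T x, y⟫_ℂ)
      linarith)
  exact ⟨g₁, g₂, h1, h2, fun k => (h3 _).trans (hA k), fun x => h4 x ▸ hB' x, h5⟩

end Compression

/-! ### Creation operators and dilations on `Γ ⊗ E` -/

section FockLemmas

variable {n : ℕ} {E F G : Type*} [NormedAddCommGroup E] [InnerProductSpace ℂ E]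
  [NormedAddCommGroup F] [InnerProductSpace ℂ F] [NormedAddCommGroup G] [InnerProductSpace ℂ G]

omit [InnerProductSpace ℂ E] in
theorem hasSum_norm_sq (f : FockTensor n E) : HasSum (fun a => ‖f a‖ ^ 2) (‖f‖ ^ 2) := by
  simpa using lp.hasSum_norm (p := 2) (by norm_num) f

theorem ampl_comp (A : F →L[ℂ] G) (B : E →L[ℂ] F) : ampl n (A ∘L B) = ampl n A ∘L ampl n B := rfl

theorem ampl_one : ampl n (1 : E →L[ℂ] E) = 1 := rfl

theorem adjoint_ampl [CompleteSpace E] [CompleteSpace F] (A : E →L[ℂ] F) :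
    (ampl n A).adjoint = ampl n A.adjoint := by
  symm
  rw [ContinuousLinearMap.eq_adjoint_iff]
  intro f g
  rw [lp.inner_eq_tsum, lp.inner_eq_tsum]
  simp only [ampl_apply, ContinuousLinearMap.adjoint_inner_left]

theorem norm_ampl_le (A : E →L[ℂ] F) : ‖ampl n A‖ ≤ ‖A‖ :=
  LinearMap.mkContinuous_norm_le _ (norm_nonneg _) _

theorem norm_rightCreation_apply_le (j : Fin n) (f : FockTensor n E) :
    ‖rightCreation E j f‖ ≤ ‖f‖ := by
  have : ‖rightCreation E j‖ ≤ 1 := LinearMap.mkContinuous_norm_le _ zero_le_one _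
  simpa using (rightCreation E j).le_of_opNorm_le this f

theorem rightCreation_apply_one (j : Fin n) (f : FockTensor n E) : rightCreation E j f 1 = 0 := by
  refine Function.extend_apply' (f := fun a => a * FreeMonoid.of j) (fun a => f a) 0 1 ?_
  rintro ⟨a, ha⟩
  simpa using congrArg FreeMonoid.length ha

theorem rightCreation_apply_mul_of (i j : Fin n) (f : FockTensor n E) (a : FreeMonoid (Fin n)) :
    rightCreation E j f (a * FreeMonoid.of i) = if j = i then f a else 0 := by
  split_ifs with h
  · subst h
    exact (mul_of_injective j).extend_apply (fun a => f a) 0 a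
  · refine Function.extend_apply' (f := fun a => a * FreeMonoid.of j) (fun a => f a) 0 _ ?_
    rintro ⟨b, hb⟩
    have : b.toList ++ [j] = a.toList ++ [i] := hb
    exact h (by simpa using (List.append_inj' this rfl).2)

/-- Words grow at the right end because right creation appends a last letter. -/
theorem word_induction {p : FreeMonoid (Fin n) → Prop} (h1 : p 1)
    (hmul : ∀ a j, p a → p (a * FreeMonoid.of j)) (a : FreeMonoid (Fin n)) : p a :=
  List.reverseRecOn (motive := fun l => p (FreeMonoid.ofList l)) a.toList h1
    fun l j hl => hmul (FreeMonoid.ofList l) j hl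

theorem inner_rightCreation_of_ne {i j : Fin n} (hij : i ≠ j) (f g : FockTensor n E) :
    ⟪rightCreation E i f, rightCreation E j g⟫_ℂ = 0 := by
  rw [lp.inner_eq_tsum]
  refine (tsum_congr fun a => ?_).trans tsum_zero
  refine word_induction (p := fun a => ⟪rightCreation E i f a, rightCreation E j g a⟫_ℂ = 0)
    ?_ (fun a k _ => ?_) a
  · rw [rightCreation_apply_one, inner_zero_left]
  · rw [rightCreation_apply_mul_of, rightCreation_apply_mul_of]
    split_ifs with h1 h2
    · exact absurd (h1.trans h2.symm) hij
    all_goals simp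

theorem creationRow_apply (f : FockTensor n (PiLp 2 (fun _ : Fin n => E))) :
    creationRow n E f =
      ∑ j, rightCreation E j (ampl n (PiLp.proj 2 (fun _ : Fin n => E) j) f) := by
  simp [creationRow]

theorem creationRow_apply_apply (f : FockTensor n (PiLp 2 (fun _ : Fin n => E)))
    (a : FreeMonoid (Fin n)) : creationRow n E f a =
      ∑ j, rightCreation E j (ampl n (PiLp.proj 2 (fun _ : Fin n => E) j) f) a := by
  rw [creationRow_apply, lp.coeFn_sum, Finset.sum_apply]

theorem creationRow_apply_one (f : FockTensor n (PiLp 2 (fun _ : Fin n => E))) :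
    creationRow n E f 1 = 0 := by
  simp [creationRow_apply_apply, rightCreation_apply_one]

theorem creationRow_apply_mul_of (f : FockTensor n (PiLp 2 (fun _ : Fin n => E)))
    (a : FreeMonoid (Fin n)) (i : Fin n) :
    creationRow n E f (a * FreeMonoid.of i) = f a i := by
  simp [creationRow_apply_apply, rightCreation_apply_mul_of]

/-- The summands are orthogonal, since words ending in different letters are different; Pythagoras
applies. -/
theorem norm_creationRow_apply_le (f : FockTensor n (PiLp 2 (fun _ : Fin n => E))) :
    ‖creationRow n E f‖ ≤ ‖f‖ := by
  rw [← sq_le_sq₀ (norm_nonneg _) (norm_nonneg _)]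
  have h1 : ‖creationRow n E f‖ ^ 2 =
      ∑ j, ‖rightCreation E j (ampl n (PiLp.proj 2 (fun _ : Fin n => E) j) f)‖ ^ 2 := by
    rw [← inner_self_eq_norm_sq (𝕜 := ℂ), creationRow_apply, sum_inner, map_sum]
    refine Finset.sum_congr rfl fun i _ => ?_
    rw [inner_sum, Finset.sum_eq_single i (fun j _ hj => inner_rightCreation_of_ne hj.symm _ _)
      (by simp), inner_self_eq_norm_sq]
  have h2 : ‖f‖ ^ 2 = ∑ j, ‖ampl n (PiLp.proj 2 (fun _ : Fin n => E) j) f‖ ^ 2 := by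
    refine (hasSum_norm_sq f).unique ?_
    have := hasSum_sum (s := Finset.univ)
      fun j _ => hasSum_norm_sq (ampl n (PiLp.proj 2 (fun _ : Fin n => E) j) f)
    simpa [PiLp.norm_sq_eq_of_L2] using this
  rw [h1, h2]
  gcongr
  exact norm_rightCreation_apply_le _ _

theorem norm_pow_smul_le {r : ℝ} (h0 : 0 ≤ r) (h1 : r ≤ 1) (k : ℕ) (x : E) :
    ‖((r : ℂ) ^ k) • x‖ ≤ ‖x‖ := by
  rw [norm_smul, norm_pow, Complex.norm_real, Real.norm_of_nonneg h0]
  exact mul_le_of_le_one_left (norm_nonneg _) (pow_le_one₀ h0 h1)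

/-- The vector obtained from `f` by multiplying the coordinate at a word `a` by `r ^ |a|`. -/
def dilate (r : ℝ) (h0 : 0 ≤ r) (h1 : r ≤ 1) (f : FockTensor n E) : FockTensor n E :=
  ⟨fun a => ((r : ℂ) ^ a.length) • f a,
    (lp.memℓp f).mono' fun a => norm_pow_smul_le h0 h1 a.length (f a)⟩

@[simp] theorem dilate_apply (r : ℝ) (h0 : 0 ≤ r) (h1 : r ≤ 1) (f : FockTensor n E)
    (a : FreeMonoid (Fin n)) : dilate r h0 h1 f a = ((r : ℂ) ^ a.length) • f a := rfl

/-- Dominated convergence over words, with each coordinate of the difference at most `2 ‖f a‖`. -/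
theorem tendsto_norm_dilate_sub {r : ℕ → ℝ} (h0 : ∀ k, 0 ≤ r k) (h1 : ∀ k, r k ≤ 1)
    (hr : Tendsto r atTop (𝓝 1)) (f : FockTensor n E) :
    Tendsto (fun k => ‖f - dilate (r k) (h0 k) (h1 k) f‖) atTop (𝓝 0) := by
  have hsq : Tendsto (fun k => ∑' a, ‖(f - dilate (r k) (h0 k) (h1 k) f) a‖ ^ 2) atTop
      (𝓝 (∑' _ : FreeMonoid (Fin n), (0 : ℝ))) := by
    refine tendsto_tsum_of_dominated_convergence (bound := fun a => (2 * ‖f a‖) ^ 2) ?_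
      (fun a => ?_) (Eventually.of_forall fun k a => ?_)
    · simp_rw [mul_pow]
      exact (hasSum_norm_sq f).summable.mul_left _
    · have hc : Tendsto (fun k => ((r k : ℂ) ^ a.length)) atTop (𝓝 ((1 : ℝ) ^ a.length : ℂ)) :=
        ((Complex.continuous_ofReal.tendsto 1).comp hr).pow _
      have := ((tendsto_const_nhds (x := f a)).sub (hc.smul_const (f a))).norm.pow 2
      simpa using this
    · rw [norm_pow, norm_norm]
      have h := norm_pow_smul_le (h0 k) (h1 k) a.length (f a)
      have h' := norm_sub_le (f a) (dilate (r k) (h0 k) (h1 k) f a)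
      rw [dilate_apply] at h'
      gcongr
      refine h'.trans ?_
      linarith
  simp_rw [(hasSum_norm_sq _).tsum_eq, tsum_zero] at hsq
  have := (Real.continuous_sqrt.tendsto 0).comp hsq
  simpa [Function.comp_def, Real.sqrt_sq] using this

end FockLemmas

/-! ### The characteristic function through backward orbits -/

section CharacteristicFunction

variable {n : ℕ} {H : Type*} [NormedAddCommGroup H] [InnerProductSpace ℂ H] [CompleteSpace H]

omit [CompleteSpace H] in
theorem row_apply (T : Fin n → H →L[ℂ] H) (h : PiLp 2 (fun _ : Fin n => H)) :
    row T h = ∑ i, T i (h i) := by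
  simp [row]

theorem adjoint_row_apply (T : Fin n → H →L[ℂ] H) (h : H) (i : Fin n) :
    (row T).adjoint h i = (T i).adjoint h := by
  have : (row T).adjoint h = WithLp.toLp 2 fun i => (T i).adjoint h := by
    refine ext_inner_right ℂ fun x => ?_
    rw [ContinuousLinearMap.adjoint_inner_left, row_apply, inner_sum, PiLp.inner_apply]
    simp [ContinuousLinearMap.adjoint_inner_left]
  rw [this]

/-- The solution `u` of the recursion `u(1) = 0`, `u(αj) = r (g(α)_j + T_j* u(α))`, read from the
last letter of the word. -/
def backwardOrbitAux (T : Fin n → H →L[ℂ] H) (r : ℝ)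
    (g : FreeMonoid (Fin n) → PiLp 2 (fun _ : Fin n => H)) : List (Fin n) → H
  | [] => 0
  | j :: l => (r : ℂ) • (g (FreeMonoid.ofList l.reverse) j +
      (T j).adjoint (backwardOrbitAux T r g l))

/-- The solution `u` of the recursion `u(1) = 0`, `u(αj) = r (g(α)_j + T_j* u(α))`. -/
def backwardOrbit (T : Fin n → H →L[ℂ] H) (r : ℝ)
    (g : FreeMonoid (Fin n) → PiLp 2 (fun _ : Fin n => H)) (a : FreeMonoid (Fin n)) : H :=
  backwardOrbitAux T r g a.toList.reverse

@[simp] theorem backwardOrbit_one (T : Fin n → H →L[ℂ] H) (r : ℝ)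
    (g : FreeMonoid (Fin n) → PiLp 2 (fun _ : Fin n => H)) : backwardOrbit T r g 1 = 0 := rfl

theorem backwardOrbit_mul_of (T : Fin n → H →L[ℂ] H) (r : ℝ)
    (g : FreeMonoid (Fin n) → PiLp 2 (fun _ : Fin n => H)) (a : FreeMonoid (Fin n)) (j : Fin n) :
    backwardOrbit T r g (a * FreeMonoid.of j) =
      (r : ℂ) • (g a j + (T j).adjoint (backwardOrbit T r g a)) := by
  simp [backwardOrbit, backwardOrbitAux]

theorem tendsto_backwardOrbit (T : Fin n → H →L[ℂ] H) {r : ℕ → ℝ} (hr : Tendsto r atTop (𝓝 1))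
    (g : FreeMonoid (Fin n) → PiLp 2 (fun _ : Fin n => H)) (a : FreeMonoid (Fin n)) :
    Tendsto (fun k => backwardOrbit T (r k) g a) atTop (𝓝 (backwardOrbit T 1 g a)) := by
  refine word_induction (p := fun a =>
    Tendsto (fun k => backwardOrbit T (r k) g a) atTop (𝓝 (backwardOrbit T 1 g a))) ?_ ?_ a
  · simp
  · intro a j h
    simp_rw [backwardOrbit_mul_of]
    exact ((Complex.continuous_ofReal.tendsto 1).comp hr).smul
      (tendsto_const_nhds.add (((T j).adjoint.continuous.tendsto _).comp h))

/-- Each letter contributes one factor `r`, so the recursion is homogeneous in word length. Hence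
the radial operator at `r`, applied to a dilated vector, is a dilation of the coordinatewise limit.
-/
theorem backwardOrbit_pow_length_smul (T : Fin n → H →L[ℂ] H) (r : ℝ)
    (g : FreeMonoid (Fin n) → PiLp 2 (fun _ : Fin n => H)) (a : FreeMonoid (Fin n)) :
    backwardOrbit T r (fun b => ((r : ℂ) ^ b.length) • g b) a =
      ((r : ℂ) ^ a.length) • backwardOrbit T 1 g a := by
  refine word_induction (p := fun a =>
    backwardOrbit T r (fun b => ((r : ℂ) ^ b.length) • g b) a =
      ((r : ℂ) ^ a.length) • backwardOrbit T 1 g a) ?_ ?_ a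
  · simp
  · intro a j h
    simp only [backwardOrbit_mul_of, h, map_smul, PiLp.smul_apply, FreeMonoid.length_mul,
      FreeMonoid.length_of, ← smul_add, smul_smul, pow_succ', Complex.ofReal_one, one_smul]

theorem isUnit_one_sub_smul {Z : Type*} [NormedAddCommGroup Z] [NormedSpace ℂ Z] [CompleteSpace Z]
    {K : Z →L[ℂ] Z} (hK : ‖K‖ ≤ 1) {r : ℝ} (h0 : 0 ≤ r) (h1 : r < 1) :
    IsUnit (1 - (r : ℂ) • K) := by
  refine isUnit_one_sub_of_norm_lt_one ?_
  rw [norm_smul, Complex.norm_real, Real.norm_of_nonneg h0]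
  exact (mul_le_of_le_one_right h0 hK).trans_lt h1

theorem inverse_one_sub_smul_apply {Z : Type*} [NormedAddCommGroup Z] [NormedSpace ℂ Z]
    [CompleteSpace Z] {K : Z →L[ℂ] Z} (hK : ‖K‖ ≤ 1) {r : ℝ} (h0 : 0 ≤ r) (h1 : r < 1) (g : Z) :
    Ring.inverse (1 - (r : ℂ) • K) g =
      (r : ℂ) • K (Ring.inverse (1 - (r : ℂ) • K) g) + g := by
  have h := congr($(Ring.mul_inverse_cancel _ (isUnit_one_sub_smul hK h0 h1)) g)
  rw [mul_apply_eq_comp, sub_apply, one_apply_eq_self, one_apply_eq_self, smul_apply] at h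
  exact sub_eq_iff_eq_add'.1 h

theorem norm_creationRow_comp_ampl_le {T : Fin n → H →L[ℂ] H} (hT : IsRowContraction T) :
    ‖creationRow n H ∘L ampl n (row T).adjoint‖ ≤ 1 := by
  have hT' : ‖ampl n (row T).adjoint‖ ≤ 1 := (norm_ampl_le _).trans (norm_adjoint_le hT)
  refine ContinuousLinearMap.opNorm_le_bound _ zero_le_one fun f => ?_
  rw [one_mul, ContinuousLinearMap.comp_apply]
  exact (norm_creationRow_apply_le _).trans (norm_apply_le hT' f)

/-- The vector `u` is the resolvent applied to `r R̃ D_T f`. Its fixed-point equation, read word by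
word, is the backward recursion. -/
theorem exists_charFnRadial_eq {T : Fin n → H →L[ℂ] H} (hT : IsRowContraction T) {r : ℝ}
    (h0 : 0 ≤ r) (h1 : r < 1) (f : FockTensor n (PiLp 2 (fun _ : Fin n => H))) :
    ∃ u : FockTensor n H,
      u = (r : ℂ) • creationRow n H (ampl n (row T).adjoint u + ampl n (defectOp (row T)) f) ∧
      charFnRadial T r f = ampl n (defectOp (row T).adjoint) u - ampl n (row T) f := by
  obtain ⟨u, hu⟩ : ∃ u, u = Ring.inverse (1 - (r : ℂ) • (creationRow n H ∘L
    ampl n (row T).adjoint)) ((r : ℂ) • creationRow n H (ampl n (defectOp (row T)) f)) := ⟨_, rfl⟩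
  refine ⟨u, ?_, ?_⟩
  · have h := inverse_one_sub_smul_apply (norm_creationRow_comp_ampl_le hT) h0 h1
      ((r : ℂ) • creationRow n H (ampl n (defectOp (row T)) f))
    rw [← hu] at h
    rw [map_add, smul_add]
    exact h
  · rw [hu, ← neg_add_eq_sub]
    rfl

theorem charFnRadial_apply {T : Fin n → H →L[ℂ] H} (hT : IsRowContraction T) {r : ℝ}
    (h0 : 0 ≤ r) (h1 : r < 1) (f : FockTensor n (PiLp 2 (fun _ : Fin n => H)))
    (a : FreeMonoid (Fin n)) :
    charFnRadial T r f a = defectOp (row T).adjoint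
      (backwardOrbit T r (fun b => defectOp (row T) (f b)) a) - row T (f a) := by
  obtain ⟨u, hu, h⟩ := exists_charFnRadial_eq hT h0 h1 f
  have hua : u a = backwardOrbit T r (fun b => defectOp (row T) (f b)) a := by
    refine word_induction (p := fun a => u a =
      backwardOrbit T r (fun b => defectOp (row T) (f b)) a) ?_ (fun a j ha => ?_) a
    · rw [hu, lp.coeFn_smul, Pi.smul_apply, creationRow_apply_one, smul_zero, backwardOrbit_one]
    · rw [hu, lp.coeFn_smul, Pi.smul_apply, creationRow_apply_mul_of, backwardOrbit_mul_of, ← ha,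
        lp.coeFn_add, Pi.add_apply, PiLp.add_apply, ampl_apply, ampl_apply, adjoint_row_apply,
        add_comm]
  rw [h, ← hua]
  rfl

/-- The Julia operator sends `(f, u)` isometrically to the pair of `T̃* u + D_T f` and the output.
As `u` is `r R̃` applied to the first component, that component is at least as long as `u`. -/
theorem norm_charFnRadial_apply_le {T : Fin n → H →L[ℂ] H} (hT : IsRowContraction T) {r : ℝ}
    (h0 : 0 ≤ r) (h1 : r < 1) (f : FockTensor n (PiLp 2 (fun _ : Fin n => H))) :
    ‖charFnRadial T r f‖ ≤ ‖f‖ := by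
  obtain ⟨u, hu, h⟩ := exists_charFnRadial_eq hT h0 h1 f
  have hu' : ‖u‖ ≤ ‖ampl n (row T).adjoint u + ampl n (defectOp (row T)) f‖ := by
    conv_lhs => rw [hu, norm_smul, Complex.norm_real, Real.norm_of_nonneg h0]
    exact (mul_le_of_le_one_left (norm_nonneg _) h1.le).trans (norm_creationRow_apply_le _)
  have hj : ‖ampl n (row T).adjoint u + ampl n (defectOp (row T)) f‖ ^ 2 +
      ‖charFnRadial T r f‖ ^ 2 = ‖f‖ ^ 2 + ‖u‖ ^ 2 := by
    rw [h]
    refine HasSum.unique ((hasSum_norm_sq _).add (hasSum_norm_sq _)) ?_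
    convert! (hasSum_norm_sq f).add (hasSum_norm_sq u) using 2 with a
    exact norm_sq_julia hT (f a) (u a)
  rw [← sq_le_sq₀ (norm_nonneg _) (norm_nonneg _)]
  have : ‖u‖ ^ 2 ≤ ‖ampl n (row T).adjoint u + ampl n (defectOp (row T)) f‖ ^ 2 := by gcongr
  linarith

/-- The strong limit of the operators `Θ_T(r R̃)`, computed coordinatewise. -/
theorem exists_charFnRadial_limit {T : Fin n → H →L[ℂ] H} (hT : IsRowContraction T)
    (f : FockTensor n (PiLp 2 (fun _ : Fin n => H))) :
    ∃ L : FockTensor n H, (∀ a, L a = defectOp (row T).adjoint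
      (backwardOrbit T 1 (fun b => defectOp (row T) (f b)) a) - row T (f a)) ∧
      Tendsto (fun r : ℝ => charFnRadial T r f) (𝓝[<] 1) (𝓝 L) := by
  have hcoord {r : ℕ → ℝ} (h0 : ∀ k, 0 ≤ r k) (h1 : ∀ k, r k < 1) (hr : Tendsto r atTop (𝓝 1)) :
      Tendsto (fun k a => charFnRadial T (r k) f a) atTop
        (𝓝 fun a => defectOp (row T).adjoint
          (backwardOrbit T 1 (fun b => defectOp (row T) (f b)) a) - row T (f a)) := by
    refine tendsto_pi_nhds.2 fun a => ?_
    simp_rw [fun k => charFnRadial_apply hT (h0 k) (h1 k) f a]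
    exact (((defectOp (row T).adjoint).continuous.tendsto _).comp
      (tendsto_backwardOrbit T hr _ a)).sub_const _
  have hmem : Memℓp (fun a => defectOp (row T).adjoint
      (backwardOrbit T 1 (fun b => defectOp (row T) (f b)) a) - row T (f a)) 2 := by
    have h0 (k : ℕ) : (0 : ℝ) ≤ 1 - 1 / (k + 1) := by
      rw [sub_nonneg, div_le_one (by positivity)]
      linarith [k.cast_nonneg (α := ℝ)]
    have h1 (k : ℕ) : (1 : ℝ) - 1 / (k + 1) < 1 := sub_lt_self _ (by positivity)
    -- A coordinatewise limit of a norm-bounded sequence is square-summable; any sequence in `[0,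
    -- 1)` tending to 1 would serve.
    refine lp.memℓp_of_tendsto (l := atTop)
      (F := fun k : ℕ => charFnRadial T (1 - 1 / ((k : ℝ) + 1)) f) ?_ (hcoord h0 h1 ?_)
    · refine isBounded_iff_forall_norm_le.2 ⟨‖f‖, ?_⟩
      rintro _ ⟨k, rfl⟩
      exact norm_charFnRadial_apply_le hT (h0 k) (h1 k) f
    · simpa using tendsto_one_div_add_atTop_nhds_zero_nat (𝕜 := ℝ) |>.const_sub 1
  let L : FockTensor n H := ⟨_, hmem⟩
  refine ⟨L, fun a => rfl, ?_⟩
  refine tendsto_of_seq_tendsto fun s hs => ?_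
  have hs1 : Tendsto s atTop (𝓝 1) := hs.mono_right nhdsWithin_le_nhds
  have hev : ∀ᶠ k in atTop, 0 ≤ s k ∧ s k < 1 :=
    (hs1.eventually (lt_mem_nhds zero_lt_one)).and
      (hs.eventually self_mem_nhdsWithin) |>.mono fun k hk => ⟨hk.1.le, hk.2⟩
  classical
  -- Values outside `[0, 1)` are replaced by 0 so that dilation makes sense for every `k`; only
  -- finitely many terms change.
  let r (k : ℕ) : ℝ := if 0 ≤ s k ∧ s k < 1 then s k else 0
  have hrs : r =ᶠ[atTop] s := hev.mono fun k hk => if_pos hk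
  have h0 (k : ℕ) : 0 ≤ r k := by
    simp only [r]
    split_ifs with h
    exacts [h.1, le_rfl]
  have h1 (k : ℕ) : r k < 1 := by
    simp only [r]
    split_ifs with h
    exacts [h.2, zero_lt_one]
  have hr : Tendsto r atTop (𝓝 1) := hs1.congr' hrs.symm
  refine Tendsto.congr' (f₁ := fun k => charFnRadial T (r k) f)
    (hrs.mono fun k hk => by simp only [hk, Function.comp_apply]) ?_
  have hdil (k : ℕ) : charFnRadial T (r k) (dilate (r k) (h0 k) (h1 k).le f) =
      dilate (r k) (h0 k) (h1 k).le L := by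
    ext a
    rw [charFnRadial_apply hT (h0 k) (h1 k), dilate_apply, dilate_apply]
    simp only [dilate_apply, map_smul, backwardOrbit_pow_length_smul, L, smul_sub]
  rw [tendsto_iff_norm_sub_tendsto_zero]
  refine squeeze_zero (fun _ => norm_nonneg _) (fun k => ?_)
    ((add_zero (0 : ℝ)) ▸ (tendsto_norm_dilate_sub h0 (fun k => (h1 k).le) hr f).add
      (tendsto_norm_dilate_sub h0 (fun k => (h1 k).le) hr L))
  -- Dilation upgrades coordinatewise to norm convergence: the radial operators are contractions,
  -- and dilations tend strongly to the identity.
  have hsplit : charFnRadial T (r k) f - L =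
      charFnRadial T (r k) (f - dilate (r k) (h0 k) (h1 k).le f) -
        (L - dilate (r k) (h0 k) (h1 k).le L) := by
    rw [map_sub, hdil]
    abel
  rw [hsplit]
  exact (norm_sub_le _ _).trans
    (add_le_add_left (norm_charFnRadial_apply_le hT (h0 k) (h1 k) _) _)

/-- The characteristic function of a row contraction exists; its coordinates are obtained from the
backward orbit of the tuple. -/
theorem charFn_spec {T : Fin n → H →L[ℂ] H} (hT : IsRowContraction T) :
    IsCharFn T (charFn T) ∧ ∀ ξ a, ((charFn T ξ a : DStarSpace T) : H) =
      defectOp (row T).adjoint (backwardOrbit T 1 (fun b => defectOp (row T) (ξ b)) a) -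
        row T (ξ a) := by
  choose L hL hlim using exists_charFnRadial_limit hT
  let Λ := continuousLinearMapOfTendsto (l := 𝓝[<] (1 : ℝ)) (charFnRadial T)
    (tendsto_pi_nhds.2 hlim)
  have hΛ (f) : Λ f = L f := rfl
  have hex : ∃ Θ, IsCharFn T Θ := by
    refine ⟨ampl n (DStarSpace T).orthogonalProjectionOnto ∘L Λ ∘L ampl n (DSpace T).subtypeL,
      fun ξ => ?_⟩
    convert! hlim (ampl n (DSpace T).subtypeL ξ) using 2
    ext a
    -- Projecting onto `𝒟_{T*}` loses nothing: `T` maps `𝒟_T` into `𝒟_{T*}`, so every coordinate of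
    -- the limit is already there.
    have hmem : L (ampl n (DSpace T).subtypeL ξ) a ∈ DStarSpace T := by
      rw [hL]
      exact sub_mem (defectMap (row T).adjoint _).2 (apply_mem_defectSpace hT (ξ a))
    exact congrArg Subtype.val
      ((DStarSpace T).orthogonalProjectionOnto_mem_subspace_eq_self ⟨_, hmem⟩)
  have hΘ : IsCharFn T (charFn T) := by
    rw [charFn, dif_pos hex]
    exact hex.choose_spec
  refine ⟨hΘ, fun ξ a => ?_⟩
  have h := tendsto_nhds_unique (hΘ ξ) (hlim (ampl n (DSpace T).subtypeL ξ))
  have ha : ((charFn T ξ a : DStarSpace T) : H) = L (ampl n (DSpace T).subtypeL ξ) a :=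
    congr(($h : FockTensor n H) a)
  rw [ha, hL]
  rfl

end CharacteristicFunction

/-! ### Componentwise operators on `Hⁿ` -/

section PiMap

variable {n : ℕ} {E F : Type*} [NormedAddCommGroup E] [InnerProductSpace ℂ E]
  [NormedAddCommGroup F] [InnerProductSpace ℂ F]

/-- The operator `Eⁿ → Fⁿ` that applies `W` to each component. -/
def piMap (n : ℕ) (W : E →L[ℂ] F) :
    PiLp 2 (fun _ : Fin n => E) →L[ℂ] PiLp 2 (fun _ : Fin n => F) :=
  (PiLp.continuousLinearEquiv 2 ℂ (fun _ : Fin n => F)).symm.toContinuousLinearMap ∘L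
    ContinuousLinearMap.pi fun j => W ∘L PiLp.proj 2 (fun _ : Fin n => E) j

@[simp] theorem piMap_apply (W : E →L[ℂ] F) (x : PiLp 2 (fun _ : Fin n => E)) (j : Fin n) :
    piMap n W x j = W (x j) := rfl

variable [CompleteSpace E] [CompleteSpace F]

theorem adjoint_piMap (W : E →L[ℂ] F) : (piMap n W).adjoint = piMap n W.adjoint := by
  symm
  rw [ContinuousLinearMap.eq_adjoint_iff]
  intro x y
  simp only [PiLp.inner_apply, piMap_apply, ContinuousLinearMap.adjoint_inner_left]

theorem adjoint_piMap_comp_self {W : E →L[ℂ] F} (hW : W.adjoint ∘L W = 1) :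
    (piMap n W).adjoint ∘L piMap n W = 1 := by
  rw [adjoint_piMap]
  ext x j
  exact congr($hW (x j))

/-- This presents the row of compressed operators as a compression of a single operator, with `Wⁿ`
on the domain side. -/
theorem row_compression (W : E →L[ℂ] F) (T : Fin n → F →L[ℂ] F) :
    row (fun i => W.adjoint ∘L T i ∘L W) = W.adjoint ∘L row T ∘L piMap n W := by
  ext x
  simp [row_apply, map_sum]

end PiMap

/-! ### Triangular tuples -/

section Triangular

variable {n : ℕ} {H : Type*} [NormedAddCommGroup H] [InnerProductSpace ℂ H]

theorem mem_of_mem_orthogonal_of_sup_eq_top {K L M : Submodule ℂ H} (hKL : K ⟂ L) (hKM : K ⟂ M)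
    (hsum : K ⊔ L ⊔ M = ⊤) {v : H} (hL : v ∈ Lᗮ) (hM : v ∈ Mᗮ) : v ∈ K := by
  have hv : v ∈ K ⊔ L ⊔ M := hsum ▸ Submodule.mem_top
  obtain ⟨w, hw, c, hc, rfl⟩ := Submodule.mem_sup.1 hv
  obtain ⟨a, ha, b, hb, rfl⟩ := Submodule.mem_sup.1 hw
  have hbL : ⟪a + b + c, b⟫_ℂ = 0 := (Submodule.mem_orthogonal' _ _).1 hL b hb
  have hcM : ⟪a + b + c, c⟫_ℂ = 0 := (Submodule.mem_orthogonal' _ _).1 hM c hc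
  have hab : ⟪a, b⟫_ℂ = 0 := hKL.inner_eq ha hb
  have hac : ⟪a, c⟫_ℂ = 0 := hKM.inner_eq ha hc
  have h : ⟪b + c, b + c⟫_ℂ = 0 := by
    have h1 : ⟪a + b + c, b + c⟫_ℂ = ⟪a, b⟫_ℂ + ⟪a, c⟫_ℂ + ⟪b + c, b + c⟫_ℂ := by
      rw [add_assoc, inner_add_left, inner_add_right]
    rw [inner_add_right, hbL, hcM, hab, hac, add_zero, zero_add] at h1
    exact h1.symm
  rw [inner_self_eq_zero] at h
  rw [add_assoc, h, add_zero]
  exact ha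

theorem apply_mem_orthogonal_of_block_eq_zero {L K : Submodule ℂ H} [L.HasOrthogonalProjection]
    {A : H →L[ℂ] H} (h : block L K A = 0) {x : H} (hx : x ∈ K) : A x ∈ Lᗮ :=
  Submodule.orthogonalProjectionOnto_eq_zero_iff.1 congr($h ⟨x, hx⟩)

variable [CompleteSpace H]

theorem adjoint_apply_mem_orthogonal {K : Submodule ℂ H} {A : H →L[ℂ] H}
    (hA : ∀ x ∈ K, A x ∈ K) {w : H} (hw : w ∈ Kᗮ) : A.adjoint w ∈ Kᗮ := by
  rw [Submodule.mem_orthogonal'] at hw ⊢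
  intro x hx
  rw [A.adjoint_inner_left]
  exact hw _ (hA x hx)

/-- If the compression of a row contraction to a subspace is a row isometry, then the components
of the range of its defect operator are orthogonal to that subspace. -/
theorem defectOp_row_apply_mem_orthogonal {T : Fin n → H →L[ℂ] H} (hT : IsRowContraction T)
    {K : Submodule ℂ H} [CompleteSpace K] {S : Fin n → K →L[ℂ] K}
    (hTS : ∀ i, block K K (T i) = S i) (hS : IsRowIsometry S)
    (f : PiLp 2 (fun _ : Fin n => H)) (j : Fin n) : defectOp (row T) f j ∈ Kᗮ := by
  rw [Submodule.mem_orthogonal']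
  intro x hx
  have hrow {E : Type _} [NormedAddCommGroup E] [InnerProductSpace ℂ E] (A : Fin n → E →L[ℂ] E)
      (y : E) : row A (PiLp.single 2 j y) = A j y := by
    simp only [row, sum_apply, ContinuousLinearMap.comp_apply]
    rw [Finset.sum_eq_single j (fun i _ hi => by simp [hi]) (by simp)]
    simp
  -- `S_j x` is a projection of `T_j x` and has length `‖x‖`. Hence `T` preserves the norm of `x` in
  -- slot `j`, and `D_T` vanishes there.
  have h1 : ‖x‖ ≤ ‖T j x‖ := by
    have h := (AddMonoidHomClass.isometry_iff_norm (row S)).1 hS (PiLp.single 2 j ⟨x, hx⟩)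
    rw [hrow, PiLp.norm_single, ← hTS] at h
    exact h.symm.trans_le (K.norm_orthogonalProjectionOnto_apply_le (T j x))
  have h2 := norm_sq_defectOp hT (PiLp.single 2 j x)
  rw [hrow, PiLp.norm_single] at h2
  have h3 : defectOp (row T) (PiLp.single 2 j x) = 0 := by
    rw [← norm_eq_zero, ← sq_eq_zero_iff]
    refine le_antisymm ?_ (sq_nonneg _)
    rw [h2, sub_nonpos]
    gcongr
  have h4 := inner_defectOp_left (row T) f (PiLp.single 2 j x)
  rw [h3, inner_zero_right, PiLp.inner_apply,
    Finset.sum_eq_single j (fun i _ hi => by simp [hi]) (by simp)] at h4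
  simpa using h4

/-- If the compression of a row contraction to a subspace is a spherical co-isometry, then the
defect operator of the adjoint vanishes on that subspace. -/
theorem defectOp_adjoint_row_eq_zero {T : Fin n → H →L[ℂ] H} (hT : IsRowContraction T)
    {K : Submodule ℂ H} [CompleteSpace K] {C : Fin n → K →L[ℂ] K}
    (hTC : ∀ i, block K K (T i) = C i) (hC : IsSphericalCoisometry C) {x : H} (hx : x ∈ K) :
    defectOp (row T).adjoint x = 0 := by
  -- `C_i* x` is the projection of `T_i* x`, so `‖x‖² = ∑ ‖C_i* x‖² ≤ ‖T* x‖²`, which leaves no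
  -- defect.
  have h1 (i : Fin n) : ‖(C i).adjoint ⟨x, hx⟩‖ ≤ ‖(T i).adjoint x‖ := by
    rw [← hTC, block, ContinuousLinearMap.adjoint_comp, ContinuousLinearMap.adjoint_comp,
      K.adjoint_subtypeL, K.adjoint_orthogonalProjectionOnto]
    exact K.norm_orthogonalProjectionOnto_apply_le _
  have h2 : ∑ i, ‖(C i).adjoint ⟨x, hx⟩‖ ^ 2 = ‖x‖ ^ 2 := by
    have hi (i : Fin n) : RCLike.re ⟪C i ((C i).adjoint ⟨x, hx⟩), (⟨x, hx⟩ : K)⟫_ℂ =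
        ‖(C i).adjoint ⟨x, hx⟩‖ ^ 2 := by
      rw [← (C i).adjoint_inner_right, inner_self_eq_norm_sq]
    have h := congr(RCLike.re ⟪$hC ⟨x, hx⟩, ⟨x, hx⟩⟫_ℂ)
    simp only [sum_apply, ContinuousLinearMap.comp_apply, sum_inner, map_sum, hi,
      one_apply_eq_self, inner_self_eq_norm_sq] at h
    exact h
  have h3 := norm_sq_defectOp (norm_adjoint_le hT) x
  rw [← norm_eq_zero, ← sq_eq_zero_iff]
  refine le_antisymm ?_ (sq_nonneg _)
  rw [h3, sub_nonpos, PiLp.norm_sq_eq_of_L2, ← h2]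
  simp only [adjoint_row_apply]
  gcongr with i
  exact h1 i

/-- Backward orbits of a triangular tuple, started in the orthogonal complement of the invariant
subspace `K`, are mapped to backward orbits of the compression by the projection onto `L`. -/
theorem backwardOrbit_compression {T : Fin n → H →L[ℂ] H} {K L : Submodule ℂ H} [CompleteSpace L]
    (hinv : ∀ i, ∀ x ∈ K, T i x ∈ K)
    (hcomp : ∀ i, ∀ x : L, T i x - L.starProjection (T i x) ∈ K)
    {g : FreeMonoid (Fin n) → PiLp 2 (fun _ : Fin n => H)} (hg : ∀ a j, g a j ∈ Kᗮ)
    {g' : FreeMonoid (Fin n) → PiLp 2 (fun _ : Fin n => L)}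
    (hg' : ∀ a j, g' a j = L.orthogonalProjectionOnto (g a j)) (a : FreeMonoid (Fin n)) :
    backwardOrbit T 1 g a ∈ Kᗮ ∧ L.orthogonalProjectionOnto (backwardOrbit T 1 g a) =
      backwardOrbit (fun i => block L L (T i)) 1 g' a := by
  -- For `x` in `L`, `T_i x` differs from its projection to `L` by a vector of `K`, which `w` does
  -- not see.
  have hadj (i : Fin n) {w : H} (hw : w ∈ Kᗮ) : L.orthogonalProjectionOnto ((T i).adjoint w) =
      (block L L (T i)).adjoint (L.orthogonalProjectionOnto w) := by
    refine ext_inner_right ℂ fun x => ?_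
    rw [ContinuousLinearMap.adjoint_inner_left, L.inner_orthogonalProjectionOnto_eq_of_mem_right,
      L.inner_orthogonalProjectionOnto_eq_of_mem_right, ContinuousLinearMap.adjoint_inner_left]
    have h := (Submodule.mem_orthogonal' _ _).1 hw _ (hcomp i x)
    rw [inner_sub_right, sub_eq_zero] at h
    exact h
  refine word_induction (p := fun a => backwardOrbit T 1 g a ∈ Kᗮ ∧
    L.orthogonalProjectionOnto (backwardOrbit T 1 g a) =
      backwardOrbit (fun i => block L L (T i)) 1 g' a) ?_ (fun a j ⟨h1, h2⟩ => ?_) a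
  · simp
  · simp only [backwardOrbit_mul_of, Complex.ofReal_one, one_smul]
    refine ⟨add_mem (hg a j) (adjoint_apply_mem_orthogonal (hinv j) h1), ?_⟩
    rw [map_add, hadj j h1, h2, hg']

end Triangular

/-! ### Combining the orbits with the constant factors -/

theorem blockDiag_apply {n : ℕ} {A A' B B' : Type*}
    [NormedAddCommGroup A] [InnerProductSpace ℂ A] [NormedAddCommGroup A'] [InnerProductSpace ℂ A']
    [NormedAddCommGroup B] [InnerProductSpace ℂ B] [NormedAddCommGroup B'] [InnerProductSpace ℂ B']
    (Φ : FockTensor n A →L[ℂ] FockTensor n A') (Ψ : FockTensor n B →L[ℂ] FockTensor n B')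
    (f : FockTensor n (WithLp 2 (A × B))) (a : FreeMonoid (Fin n)) :
    blockDiag Φ Ψ f a = WithLp.toLp 2 (Φ (ampl n (WithLp.fstL 2 ℂ A B) f) a,
      Ψ (ampl n (WithLp.sndL 2 ℂ A B) f) a) := by
  have h : blockDiag Φ Ψ f a = inlL A' B' (Φ (ampl n (WithLp.fstL 2 ℂ A B) f) a) +
      inrL A' B' (Ψ (ampl n (WithLp.sndL 2 ℂ A B) f) a) := rfl
  rw [h, inlL_apply, inrL_apply, ← WithLp.toLp_add, Prod.mk_add_mk, add_zero, zero_add]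

theorem ampl_comp_adjoint {n : ℕ} {E F : Type*} [NormedAddCommGroup E] [InnerProductSpace ℂ E]
    [CompleteSpace E] [NormedAddCommGroup F] [InnerProductSpace ℂ F] [CompleteSpace F]
    {g : E →L[ℂ] F} (hg : g ∘L g.adjoint = 1) : ampl n g ∘L (ampl n g).adjoint = 1 := by
  rw [adjoint_ampl, ← ampl_comp, hg, ampl_one]

theorem adjoint_comp_ampl {n : ℕ} {E F : Type*} [NormedAddCommGroup E] [InnerProductSpace ℂ E]
    [CompleteSpace E] [NormedAddCommGroup F] [InnerProductSpace ℂ F] [CompleteSpace F]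
    {g : E →L[ℂ] F} (hg : g.adjoint ∘L g = 1) : (ampl n g).adjoint ∘L ampl n g = 1 := by
  rw [adjoint_ampl, ← ampl_comp, hg, ampl_one]

set_option maxHeartbeats 1000000 in
theorem charFn_eq_of_constant_factors {n : ℕ} {H E : Type*} [NormedAddCommGroup H]
    [InnerProductSpace ℂ H] [CompleteSpace H] [NormedAddCommGroup E] [InnerProductSpace ℂ E]
    {T : Fin n → H →L[ℂ] H} (hT : ‖row T‖ ≤ 1) {K L : Submodule ℂ H} [CompleteSpace L]
    (hinv : ∀ i, ∀ x ∈ K, T i x ∈ K)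
    (hcomp : ∀ i, ∀ x : L, T i x - L.starProjection (T i x) ∈ K)
    (hker : ∀ w ∈ Kᗮ, defectOp (row T).adjoint w =
      defectOp (row T).adjoint (L.orthogonalProjectionOnto w))
    (hdef : ∀ f j, defectOp (row T) f j ∈ Kᗮ)
    {N : Fin n → L →L[ℂ] L} (hNT : N = fun i => block L L (T i)) (hN : ‖row N‖ ≤ 1)
    {g₁ : WithLp 2 (DStarSpace N × E) →L[ℂ] DStarSpace T}
    {g₂ : DSpace T →L[ℂ] WithLp 2 (DSpace N × E)}
    (hg₁ : ∀ k, g₁ (WithLp.toLp 2 (defectMap (row N).adjoint k, 0)) =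
      defectMap (row T).adjoint (L.subtypeL k))
    (hg₂ : ∀ x j, defectOp (row N) (g₂ x).fst j =
      L.orthogonalProjectionOnto (defectOp (row T) x j))
    (hconst : ∀ x, g₁ (WithLp.toLp 2 (-defectRestrict (row N) hN (g₂ x).fst, (g₂ x).snd)) =
      -defectRestrict (row T) hT x) :
    charFn T = ampl n g₁ ∘L blockDiag (charFn N) (1 : FockTensor n E →L[ℂ] FockTensor n E) ∘L
      ampl n g₂ := by
  refine ContinuousLinearMap.ext fun ξ => lp.ext (funext fun a => ?_)
  obtain ⟨η, hη⟩ : ∃ η, η = ampl n (WithLp.fstL 2 ℂ (DSpace N) E) (ampl n g₂ ξ) := ⟨_, rfl⟩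
  obtain ⟨w, hw⟩ : ∃ w, w = backwardOrbit T 1 (fun b => defectOp (row T) (ξ b)) a := ⟨_, rfl⟩
  obtain ⟨v, hv⟩ : ∃ v, v = backwardOrbit N 1 (fun b => defectOp (row N) (η b)) a := ⟨_, rfl⟩
  have hηa (b) : η b = (g₂ (ξ b)).fst := by rw [hη]; rfl
  obtain ⟨hmem, hproj⟩ := backwardOrbit_compression hinv hcomp
    (g := fun b => defectOp (row T) (ξ b)) (fun b j => hdef _ j)
    (g' := fun b => defectOp (row N) (η b)) (fun b j => by rw [hηa]; exact hg₂ _ _) a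
  rw [← hNT, ← hw, ← hv] at hproj
  rw [← hw] at hmem
  have hΘN : charFn N η a = defectMap (row N).adjoint v - defectRestrict (row N) hN (η a) := by
    refine Subtype.ext ?_
    rw [(charFn_spec hN).2, hv]
    rfl
  have hΘT : charFn T ξ a = defectMap (row T).adjoint w - defectRestrict (row T) hT (ξ a) := by
    refine Subtype.ext ?_
    rw [(charFn_spec hT).2, hw]
    rfl
  have hmap : defectMap (row T).adjoint w = defectMap (row T).adjoint (L.subtypeL v) := by
    refine Subtype.ext ?_
    rw [coe_defectMap, coe_defectMap, hker w hmem, hproj]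
    rfl
  have hrhs : (ampl n g₁ ∘L blockDiag (charFn N) (1 : FockTensor n E →L[ℂ] FockTensor n E) ∘L
      ampl n g₂) ξ a = g₁ (WithLp.toLp 2 (charFn N η a, (g₂ (ξ a)).snd)) := by
    rw [hη]
    exact congrArg g₁ (blockDiag_apply _ _ _ _)
  -- The first summand carries the orbit and is handled by `hg₁`; the second carries the constant
  -- term together with the `E`-component and is handled by `hconst`.
  have hadd : (WithLp.toLp 2 (charFn N η a, (g₂ (ξ a)).snd) : WithLp 2 (DStarSpace N × E)) =
      WithLp.toLp 2 (defectMap (row N).adjoint v, 0) +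
        WithLp.toLp 2 (-defectRestrict (row N) hN (η a), (g₂ (ξ a)).snd) := by
    rw [← WithLp.toLp_add, Prod.mk_add_mk, zero_add, hΘN, sub_eq_add_neg]
  rw [hrhs, hadd, map_add, hg₁, hηa, hconst, hΘT, hmap, sub_eq_add_neg]

end RowContraction

end

/-! ### The factorization theorem -/

open RowContraction
set_option maxHeartbeats 2000000 in
theorem mainTheorem8 (n : ℕ) (H : Type u) [NormedAddCommGroup H] [InnerProductSpace ℂ H]
    [CompleteSpace H]
    -- `H = K₁ ⊕ K₀ ⊕ K₂` (orthogonal direct sum of closed subspaces)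
    (K₁ K₀ K₂ : Submodule ℂ H) [CompleteSpace K₁] [CompleteSpace K₀] [CompleteSpace K₂]
    (h10 : K₁ ⟂ K₀) (h12 : K₁ ⟂ K₂) (h02 : K₀ ⟂ K₂) (hsum : K₁ ⊔ K₀ ⊔ K₂ = ⊤)
    (T : Fin n → H →L[ℂ] H) (hT : IsRowContraction T)
    (S : Fin n → K₁ →L[ℂ] K₁) (N : Fin n → K₀ →L[ℂ] K₀) (C : Fin n → K₂ →L[ℂ] K₂)
    -- the operator matrix of `T i` is upper triangular with diagonal `S i, N i, C i`
    (hTS : ∀ i, block K₁ K₁ (T i) = S i)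
    (hTN : ∀ i, block K₀ K₀ (T i) = N i)
    (hTC : ∀ i, block K₂ K₂ (T i) = C i)
    (hT01 : ∀ i, block K₀ K₁ (T i) = 0)
    (hT21 : ∀ i, block K₂ K₁ (T i) = 0)
    (hT20 : ∀ i, block K₂ K₀ (T i) = 0)
    (hS : IsRowIsometry S) (hC : IsSphericalCoisometry C) :
    IsRowContraction N ∧ IsCharFn T (charFn T) ∧ IsCharFn N (charFn N) ∧
    ∃ (E : Type u) (_ : NormedAddCommGroup E) (_ : InnerProductSpace ℂ E) (_ : CompleteSpace E)
      (g₁ : WithLp 2 (DStarSpace N × E) →L[ℂ] DStarSpace T)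
      (g₂ : DSpace T →L[ℂ] WithLp 2 (DSpace N × E))
      (G₁ : FockTensor n (WithLp 2 (DStarSpace N × E)) →L[ℂ] FockTensor n (DStarSpace T))
      (G₂ : FockTensor n (DSpace T) →L[ℂ] FockTensor n (WithLp 2 (DSpace N × E))),
      G₁ = ampl n g₁ ∧ G₂ = ampl n g₂ ∧
      G₁ ∘L ContinuousLinearMap.adjoint G₁ = 1 ∧
      ContinuousLinearMap.adjoint G₂ ∘L G₂ = 1 ∧
      charFn T = G₁ ∘L blockDiag (charFn N) (1 : FockTensor n E →L[ℂ] FockTensor n E) ∘L G₂ := by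
  obtain rfl : (fun i => block K₀ K₀ (T i)) = N := funext hTN
  have hinv (i : Fin n) (x : H) (hx : x ∈ K₁) : T i x ∈ K₁ :=
    mem_of_mem_orthogonal_of_sup_eq_top h10 h12 hsum
      (apply_mem_orthogonal_of_block_eq_zero (hT01 i) hx)
      (apply_mem_orthogonal_of_block_eq_zero (hT21 i) hx)
  have hcomp (i : Fin n) (x : K₀) : T i x - K₀.starProjection (T i x) ∈ K₁ := by
    refine mem_of_mem_orthogonal_of_sup_eq_top h10 h12 hsum
      (K₀.sub_starProjection_mem_orthogonal _) (sub_mem ?_ ?_)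
    · exact apply_mem_orthogonal_of_block_eq_zero (hT20 i) x.2
    · exact h02.le (K₀.starProjection_apply_mem _)
  -- For `w` in `K₁ᗮ`, the vector `w - P₀ w` lies in `K₂`, where `D_{T*}` vanishes.
  have hker {w : H} (hw : w ∈ K₁ᗮ) : defectOp (row T).adjoint w =
      defectOp (row T).adjoint (K₀.orthogonalProjectionOnto w) := by
    rw [← sub_eq_zero, ← map_sub]
    refine defectOp_adjoint_row_eq_zero hT hTC hC ?_
    refine mem_of_mem_orthogonal_of_sup_eq_top h12.symm h02.symm ?_ (sub_mem hw ?_)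
      (K₀.sub_starProjection_mem_orthogonal _)
    · rw [← hsum, sup_assoc, sup_comm]
    · exact h10.symm.le (K₀.starProjection_apply_mem _)
  have hW : K₀.subtypeL.adjoint ∘L K₀.subtypeL = 1 := by
    rw [K₀.adjoint_subtypeL]
    ext x
    simp
  have hV := adjoint_piMap_comp_self (n := n) hW
  have hNT : row (fun i => block K₀ K₀ (T i)) =
      K₀.subtypeL.adjoint ∘L row T ∘L piMap n K₀.subtypeL := by
    rw [← row_compression, K₀.adjoint_subtypeL]
    rfl
  have hN : ‖row (fun i => block K₀ K₀ (T i))‖ ≤ 1 := hNT ▸ norm_compression_le hT hV hW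
  obtain ⟨g₁, g₂, hg₁, hg₂, hg₁D, hg₂D, hconst⟩ := exists_constant_factors hT hV hW hNT hN
  -- The space `E` is `𝒟_T ⊕ 𝒟_{T*}`, where the Gram pair takes its values; unification supplies it
  -- from the type of `g₁`.
  refine ⟨hN, (charFn_spec hT).1, (charFn_spec hN).1, _, _, _, inferInstance, g₁, g₂, _, _, rfl,
    rfl, ampl_comp_adjoint hg₁, adjoint_comp_ampl hg₂, ?_⟩
  refine charFn_eq_of_constant_factors hT hinv hcomp (fun w hw => hker hw)
    (fun f j => defectOp_row_apply_mem_orthogonal hT hTS hS f j) rfl hN hg₁D (fun x j => ?_) hconst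
  rw [hg₂D, adjoint_piMap, K₀.adjoint_subtypeL]
  rfl
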